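/- Let $X$ be a finite alphabet and let $X^*$ be the rooted tree of finite words over $X$: the root is the empty word, and each $v\in X^*$ is joined by an edge to $vx$ for every $x\in X$. Let $\operatorname{Aut}X^*$ be the group of automorphisms of this rooted tree. For $g\in\operatorname{Aut}X^*$ and $v\in X^*$, the section of $g$ at $v$ is the automorphism $g|_v\in\operatorname{Aut}X^*$ determined by $g(vw)=g(v)\,g|_v(w)$ for all $w\in X^*$. The automorphism $g$ is finite-state if the set $\{g|_v : v\in X^*\}$ is finite. For $n\ge 0$, let $\alpha_n(g)$ be the number of words $v$ of length $n$ such that $g|_v\neq 1$. Let $P_1(X)$ be the group of all finite-state $g\in\operatorname{Aut}X^*$ of at most linear activity growth, that is, such that $\alpha_n(g)$ is bounded above by a polynomial in $n$ of degree at most $1$. Theorem. For every finite alphabet $X$, the (discrete) group $P_1(X)$ is amenable: there is a finitely additive map $\mu$ from the set of all subsets of $P_1(X)$ to $[0,1]$ such that $\mu(P_1(X))=1$ and $\mu(gA)=\mu(A)$ for all $g\in P_1(X)$ and $A\subseteq P_1(X)$. -/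

import Mathlib

open scoped Pointwise

/-! ### Amenability -/

/-- An action of a (discrete) group `G` on a set `Y` is amenable if there is an invariant mean
on `Y`: a finitely additive map `μ` from the set of all subsets of `Y` to `[0, 1]` with `μ Y = 1`
and `μ (g A) = μ A` for all `A ⊆ Y` and `g ∈ G`. -/
def IsAmenableAction (G : Type*) [Group G] (Y : Type*) [MulAction G Y] : Prop :=
  ∃ μ : Set Y → ℝ,
    (∀ A, μ A ∈ Set.Icc (0 : ℝ) 1) ∧
    (∀ A B, Disjoint A B → μ (A ∪ B) = μ A + μ B) ∧
    μ Set.univ = 1 ∧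
    ∀ (g : G) (A : Set Y), μ (g • A) = μ A

/-- A group is amenable if its action on itself by left multiplication is amenable. -/
def IsAmenableGroup (G : Type*) [Group G] : Prop :=
  IsAmenableAction G G

/-! ### The rooted tree of words and its automorphisms -/

/-- The tree of finite words over `X`: two words are connected by an edge if and only if one of
them is obtained from the other by appending one letter. -/
def wordTree (X : Type*) : SimpleGraph (List X) where
  Adj u v := (∃ x, v = u ++ [x]) ∨ ∃ x, u = v ++ [x]
  symm := ⟨fun _ _ h => h.symm⟩
  loopless := ⟨fun u h => by simp at h⟩

/-- The group of automorphisms of the rooted tree of words over `X`, that is, the graph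
automorphisms that fix the root (the empty word). Products are compositions:
`(g * h) v = g (h v)`. -/
def treeAut (X : Type*) : Subgroup (wordTree X ≃g wordTree X) where
  carrier := {g | g [] = []}
  one_mem' := rfl
  mul_mem' {g h} hg hh := by
    change g (h []) = []
    rw [show h [] = [] from hh]
    exact hg
  inv_mem' {g} hg := by
    change g.symm [] = []
    rw [← show g [] = [] from hg]
    simp only [show g [] = [] from hg]
    exact (RelIso.symm_apply_eq g).2 (show g [] = [] from hg).symm

namespace treeAut

variable {X : Type*}

theorem adj_append_left (v a b : List X) :
    (wordTree X).Adj (v ++ a) (v ++ b) ↔ (wordTree X).Adj a b := by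
  simp [wordTree, List.append_assoc]

theorem adj_snoc (u : List X) (x : X) : (wordTree X).Adj u (u ++ [x]) :=
  Or.inl ⟨x, rfl⟩

theorem mul_apply (g h : treeAut X) (v : List X) : (g * h).1 v = g.1 (h.1 v) := rfl

theorem one_apply (v : List X) : (1 : treeAut X).1 v = v := rfl

theorem inv_apply_self (g : treeAut X) (v : List X) : (g⁻¹).1 (g.1 v) = v := by
  rw [← mul_apply, inv_mul_cancel, one_apply]

theorem apply_inv_self (g : treeAut X) (v : List X) : g.1 ((g⁻¹).1 v) = v := by
  rw [← mul_apply, mul_inv_cancel, one_apply]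

theorem ext' {g h : treeAut X} (H : ∀ v, g.1 v = h.1 v) : g = h :=
  Subtype.ext (RelIso.ext H)

theorem snoc_apply (g : treeAut X) (u : List X) :
    ∀ x, ∃ y, g.1 (u ++ [x]) = g.1 u ++ [y] := by
  induction u using List.reverseRecOn with
  | nil =>
    intro x
    have h : (wordTree X).Adj (g.1 []) (g.1 ([] ++ [x])) :=
      (g.1.map_rel_iff).2 (adj_snoc [] x)
    have h0 : g.1 [] = [] := g.2
    rw [h0] at h ⊢
    rcases h with h | ⟨y, hy⟩
    · exact h
    · simp at hy
  | append_singleton u z ih =>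
    intro x
    have h : (wordTree X).Adj (g.1 (u ++ [z])) (g.1 (u ++ [z] ++ [x])) :=
      (g.1.map_rel_iff).2 (adj_snoc _ x)
    rcases h with h | ⟨y, hy⟩
    · exact h
    · obtain ⟨y', hy'⟩ := ih z
      rw [hy'] at hy
      have h1 := (List.append_inj' hy rfl).1
      have h2 := g.1.injective h1
      simp [List.append_assoc] at h2

theorem exists_apply_append (g : treeAut X) (v w : List X) :
    ∃ w', w'.length = w.length ∧ g.1 (v ++ w) = g.1 v ++ w' := by
  induction w using List.reverseRecOn with
  | nil => exact ⟨[], rfl, by simp⟩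
  | append_singleton w x ih =>
    obtain ⟨w', hl, hw⟩ := ih
    obtain ⟨y, hy⟩ := snoc_apply g (v ++ w) x
    refine ⟨w' ++ [y], by simp [hl], ?_⟩
    rw [← List.append_assoc, hy, hw, List.append_assoc]

theorem length_apply (g : treeAut X) (v : List X) : (g.1 v).length = v.length := by
  obtain ⟨w', hl, hw⟩ := exists_apply_append g [] v
  have h0 : g.1 [] = [] := g.2
  rw [h0] at hw
  simp only [List.nil_append] at hw
  rw [hw, hl]

theorem apply_append_drop (g : treeAut X) (v w : List X) :
    g.1 (v ++ w) = g.1 v ++ (g.1 (v ++ w)).drop v.length := by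
  obtain ⟨w', -, hw⟩ := exists_apply_append g v w
  rw [hw, ← length_apply g v, List.drop_left]

/-- The section `g|_v`: the automorphism determined by `g (v w) = g v · g|_v w`. -/
def sectionAt (g : treeAut X) (v : List X) : treeAut X :=
  ⟨{ toFun := fun w => (g.1 (v ++ w)).drop v.length
     invFun := fun w => ((g⁻¹).1 (g.1 v ++ w)).drop v.length
     left_inv := fun w => by
       dsimp only
       rw [← apply_append_drop, inv_apply_self, List.drop_left]
     right_inv := fun w => by
       dsimp only
       have h := apply_append_drop g⁻¹ (g.1 v) w
       rw [inv_apply_self, length_apply] at h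
       rw [← h, apply_inv_self, ← length_apply g v, List.drop_left]
     map_rel_iff' := fun {a b} => by
       change (wordTree X).Adj ((g.1 (v ++ a)).drop v.length) ((g.1 (v ++ b)).drop v.length) ↔ _
       rw [← adj_append_left (g.1 v), ← apply_append_drop, ← apply_append_drop,
         ← adj_append_left v a b]
       exact g.1.map_rel_iff }, by
    change (g.1 (v ++ [])).drop v.length = []
    rw [List.append_nil, ← length_apply g v, List.drop_length]⟩

theorem apply_append (g : treeAut X) (v w : List X) :
    g.1 (v ++ w) = g.1 v ++ (sectionAt g v).1 w :=
  apply_append_drop g v w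

theorem eq_sectionAt (g h : treeAut X) (v : List X)
    (H : ∀ w, g.1 (v ++ w) = g.1 v ++ h.1 w) : h = sectionAt g v :=
  ext' fun w => List.append_cancel_left ((H w).symm.trans (apply_append g v w))

theorem sectionAt_one (v : List X) : sectionAt 1 v = 1 :=
  (eq_sectionAt 1 1 v fun _ => rfl).symm

theorem sectionAt_mul (g h : treeAut X) (v : List X) :
    sectionAt (g * h) v = sectionAt g (h.1 v) * sectionAt h v := by
  refine (eq_sectionAt _ _ v fun w => ?_).symm
  rw [mul_apply, mul_apply, mul_apply, apply_append h, apply_append g]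

theorem sectionAt_inv (g : treeAut X) (v : List X) :
    sectionAt g⁻¹ v = (sectionAt g ((g⁻¹).1 v))⁻¹ := by
  rw [eq_inv_iff_mul_eq_one]
  have h := sectionAt_mul g⁻¹ g ((g⁻¹).1 v)
  rw [apply_inv_self, inv_mul_cancel, sectionAt_one] at h
  exact h.symm

/-- `g` is finite-state if it has finitely many distinct sections. -/
def IsFiniteState (g : treeAut X) : Prop :=
  (Set.range (sectionAt g)).Finite

/-- The activity `α_n(g)`: the number of words `v` of length `n` such that `g|_v ≠ 1`. -/
noncomputable def activity (g : treeAut X) (n : ℕ) : ℕ :=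
  {v : List X | v.length = n ∧ sectionAt g v ≠ 1}.ncard

/-- The activity of `g` is bounded by a polynomial of degree at most `d`. -/
def HasActivityDegreeLE (d : ℕ) (g : treeAut X) : Prop :=
  ∃ p : Polynomial ℝ, p.natDegree ≤ d ∧ ∀ n : ℕ, (activity g n : ℝ) ≤ p.eval (n : ℝ)

theorem IsFiniteState.mul {g h : treeAut X} (hg : IsFiniteState g) (hh : IsFiniteState h) :
    IsFiniteState (g * h) := by
  refine (Set.Finite.mul hg hh).subset ?_
  rintro _ ⟨v, rfl⟩
  rw [sectionAt_mul]
  exact Set.mul_mem_mul ⟨_, rfl⟩ ⟨_, rfl⟩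

theorem IsFiniteState.inv {g : treeAut X} (hg : IsFiniteState g) : IsFiniteState g⁻¹ := by
  refine (Set.Finite.inv hg).subset ?_
  rintro _ ⟨v, rfl⟩
  rw [sectionAt_inv]
  exact Set.inv_mem_inv.2 ⟨_, rfl⟩

theorem finite_active [Finite X] (g : treeAut X) (n : ℕ) :
    {v : List X | v.length = n ∧ sectionAt g v ≠ 1}.Finite :=
  (List.finite_length_eq X n).subset fun _ hv => hv.1

theorem activity_one (n : ℕ) : activity (1 : treeAut X) n = 0 := by
  simp [activity, sectionAt_one]

theorem activity_mul_le [Finite X] (g h : treeAut X) (n : ℕ) :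
    activity (g * h) n ≤ activity g n + activity h n := by
  have hsub : {v : List X | v.length = n ∧ sectionAt (g * h) v ≠ 1} ⊆
      (h⁻¹).1 '' {v : List X | v.length = n ∧ sectionAt g v ≠ 1} ∪
        {v : List X | v.length = n ∧ sectionAt h v ≠ 1} := by
    rintro v ⟨hv, hs⟩
    by_cases hh : sectionAt h v = 1
    · refine Or.inl ⟨h.1 v, ⟨by rw [length_apply, hv], fun hg => hs ?_⟩, inv_apply_self h v⟩
      rw [sectionAt_mul, hg, hh, one_mul]
    · exact Or.inr ⟨hv, hh⟩
  refine (Set.ncard_le_ncard hsub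
    (((finite_active g n).image _).union (finite_active h n))).trans
    ((Set.ncard_union_le _ _).trans ?_)
  exact Nat.add_le_add_right (Set.ncard_image_le (finite_active g n)) _

theorem activity_inv_le [Finite X] (g : treeAut X) (n : ℕ) :
    activity g⁻¹ n ≤ activity g n := by
  have hsub : {v : List X | v.length = n ∧ sectionAt g⁻¹ v ≠ 1} ⊆
      g.1 '' {v : List X | v.length = n ∧ sectionAt g v ≠ 1} := by
    rintro v ⟨hv, hs⟩
    refine ⟨(g⁻¹).1 v, ⟨by rw [length_apply, hv], fun hg => hs ?_⟩, apply_inv_self g v⟩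
    rw [sectionAt_inv, hg, inv_one]
  exact (Set.ncard_le_ncard hsub ((finite_active g n).image _)).trans
    (Set.ncard_image_le (finite_active g n))

end treeAut

/-- The group `P_d(X)` of finite-state automorphisms `g` of the rooted tree of words over the
finite alphabet `X` such that `α_n(g)` is bounded by a polynomial of degree at most `d` in `n`;
`P_1(X)` is the group of finite-state automorphisms of linear activity growth. -/
def polyActivityGroup (d : ℕ) (X : Type*) [Finite X] : Subgroup (treeAut X) where
  carrier := {g | treeAut.IsFiniteState g ∧ treeAut.HasActivityDegreeLE d g}
  one_mem' := by
    refine ⟨(Set.finite_singleton (1 : treeAut X)).subset ?_, 0, by simp, fun n => ?_⟩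
    · rintro _ ⟨v, rfl⟩
      exact treeAut.sectionAt_one v
    · simp [treeAut.activity_one]
  mul_mem' := by
    rintro g h ⟨hg, p, hp, hpn⟩ ⟨hh, q, hq, hqn⟩
    refine ⟨hg.mul hh, p + q, Polynomial.natDegree_add_le_of_degree_le hp hq, fun n => ?_⟩
    rw [Polynomial.eval_add]
    refine le_trans ?_ (add_le_add (hpn n) (hqn n))
    exact_mod_cast treeAut.activity_mul_le g h n
  inv_mem' := by
    rintro g ⟨hg, p, hp, hpn⟩
    refine ⟨hg.inv, p, hp, fun n => le_trans ?_ (hpn n)⟩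
    exact_mod_cast treeAut.activity_inv_le g n

/-! Call an infinite word singular for `g` over a subgroup `P` if no section of `g` along its
prefixes lies in `P`. In the chain formed by the finitary automorphisms, `boundedSubgroup X` and
`P_1(X)`, every element of a group has only finitely many singular points over the preceding group
(`finite_singularSet_boundedSubgroup` is the counting argument for the top step). The finitary group
is an increasing union of finite groups, so it has an invariant mean, and one argument, used twice,
climbs the chain.

To pass from `P` to `G`, let `G` act on the finite sets of infinite words, and suppose that there is
an invariant mean for which, given `g`, almost every set `A` contains the singular points of `g`.
The pairs `(g, A)` with this property form a subgroupoid of full measure of the action groupoid, so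
by `HasInvariantMean.of_groupoid` only its isotropy groups matter. A finite-index subgroup of such a
group fixes `A` pointwise and is singular only inside `A`. The points of `A` are removed one at a
time: a point that is not eventually periodic cannot be singular for a finite-state element, and at
an eventually periodic point the germs are described by self-similar elements, which embed, up to
finite index, in a power of `P` (`hasInvariantMean_of_fix`).

The mean is a limit of product Bernoulli measures (`exists_mean_finset`). These need finitely
supported functions of small Dirichlet energy that equal one at the singular points. Let `T` be a
suitable finite set of tails, and let the `n`-th set consist of the words whose `n`-th tail is in
`T`. An element can move a word out of this set only if it is active at the prefix of length `n`, so
linear activity makes the boundaries grow at most linearly. Weighting these sets by `1 / (n + 1)`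
gives energy at most a constant divided by a harmonic sum, which tends to zero because the harmonic
series diverges. -/

/-! ### Invariant means as functionals on bounded functions -/

/-- A real function is bounded. -/
def IsBddFun {Y : Type*} (f : Y → ℝ) : Prop := ∃ C, ∀ y, |f y| ≤ C

theorem IsBddFun.comp {Y Z : Type*} {f : Y → ℝ} (hf : IsBddFun f) (φ : Z → Y) :
    IsBddFun fun z => f (φ z) :=
  let ⟨C, hC⟩ := hf
  ⟨C, fun z => hC (φ z)⟩

theorem IsBddFun.add {Y : Type*} {f g : Y → ℝ} (hf : IsBddFun f) (hg : IsBddFun g) :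
    IsBddFun fun y => f y + g y :=
  let ⟨C, hC⟩ := hf
  let ⟨D, hD⟩ := hg
  ⟨C + D, fun y => (abs_add_le _ _).trans (add_le_add (hC y) (hD y))⟩

theorem isBddFun_const {Y : Type*} (c : ℝ) : IsBddFun fun _ : Y => c :=
  ⟨|c|, fun _ => le_rfl⟩

theorem isBddFun_indicator {Y : Type*} (A : Set Y) : IsBddFun (A.indicator fun _ => (1 : ℝ)) :=
  ⟨1, fun y => by by_cases h : y ∈ A <;> simp [h]⟩

/-- A mean on `Y`: a positive additive normalized functional on bounded functions. -/
structure IsMean {Y : Type*} (m : (Y → ℝ) → ℝ) : Prop where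
  add : ∀ {f g : Y → ℝ}, IsBddFun f → IsBddFun g → m (fun y => f y + g y) = m f + m g
  mono : ∀ {f g : Y → ℝ}, IsBddFun f → IsBddFun g → (∀ y, f y ≤ g y) → m f ≤ m g
  const : ∀ c : ℝ, m (fun _ => c) = c

theorem IsMean.abs_le {Y : Type*} {m : (Y → ℝ) → ℝ} (hm : IsMean m) {f : Y → ℝ} {C : ℝ}
    (hC : ∀ y, |f y| ≤ C) : |m f| ≤ C := by
  have hf : IsBddFun f := ⟨C, hC⟩
  refine _root_.abs_le.2 ⟨?_, ?_⟩
  · rw [← hm.const (-C)]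
    exact hm.mono (isBddFun_const _) hf fun y => (_root_.abs_le.1 (hC y)).1
  · rw [← hm.const C]
    exact hm.mono hf (isBddFun_const _) fun y => (_root_.abs_le.1 (hC y)).2

theorem IsMean.comap {Y Z : Type*} {m : (Y → ℝ) → ℝ} (hm : IsMean m) (φ : Y → Z) :
    IsMean fun f : Z → ℝ => m fun y => f (φ y) where
  add hf hg := hm.add (hf.comp φ) (hg.comp φ)
  mono hf hg h := hm.mono (hf.comp φ) (hg.comp φ) fun y => h (φ y)
  const c := hm.const c

/-- Integration of a family of means against a mean; no measurability is involved, since means are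
defined on all bounded functions. -/
theorem IsMean.bind {Y Z : Type*} {m : (Z → ℝ) → ℝ} (hm : IsMean m)
    {n : Z → (Y → ℝ) → ℝ} (hn : ∀ z, IsMean (n z)) : IsMean fun f => m fun z => n z f := by
  have hb : ∀ f : Y → ℝ, IsBddFun f → IsBddFun fun z => n z f := fun f ⟨C, hC⟩ =>
    ⟨C, fun z => (hn z).abs_le hC⟩
  refine ⟨fun {f g} hf hg => ?_, fun {f g} hf hg h => ?_, fun c => ?_⟩
  · rw [← hm.add (hb f hf) (hb g hg)]
    congr 1
    exact funext fun z => (hn z).add hf hg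
  · exact hm.mono (hb f hf) (hb g hg) fun z => (hn z).mono hf hg h
  · simp only [(hn _).const, hm.const]

/-- A limit of means along an ultrafilter. -/
theorem exists_limit_mean {ι Y : Type*} (l : Filter ι) [l.NeBot] (m : ι → (Y → ℝ) → ℝ)
    (hm : ∀ i, IsMean (m i)) :
    ∃ M : (Y → ℝ) → ℝ, IsMean M ∧ ∀ f g : Y → ℝ, IsBddFun f → IsBddFun g →
      Filter.Tendsto (fun i => m i f - m i g) l (nhds 0) → M f = M g := by
  let U : Ultrafilter ι := Ultrafilter.of l
  have hU : (U : Filter ι) ≤ l := Ultrafilter.of_le l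
  have hlim : ∀ f : Y → ℝ, ∃ x, IsBddFun f → Filter.Tendsto (fun i => m i f) U (nhds x) := by
    intro f
    by_cases hf : IsBddFun f
    · obtain ⟨C, hC⟩ := hf
      have hK : IsCompact (Set.Icc (-C) C) := isCompact_Icc
      have := hK.ultrafilter_le_nhds (U.map fun i => m i f) (by
        rw [Filter.le_principal_iff]
        exact Filter.mem_map.2 (Filter.univ_mem' fun i => abs_le.1 ((hm i).abs_le hC)))
      obtain ⟨x, -, hx⟩ := this
      exact ⟨x, fun _ => hx⟩
    -- A default value: the limit is only used on bounded functions.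
    · exact ⟨0, fun h => absurd h hf⟩
  choose M hM using hlim
  refine ⟨M, ⟨fun {f g} hf hg => ?_, fun {f g} hf hg h => ?_, fun c => ?_⟩, fun f g hf hg h => ?_⟩
  · refine tendsto_nhds_unique (hM _ (hf.add hg)) ?_
    simp only [(hm _).add hf hg]
    exact (hM f hf).add (hM g hg)
  · exact le_of_tendsto_of_tendsto' (hM f hf) (hM g hg) fun i => (hm i).mono hf hg h
  · refine tendsto_nhds_unique (hM _ (isBddFun_const c)) ?_
    simp only [(hm _).const]
    exact tendsto_const_nhds
  · exact sub_eq_zero.1 (tendsto_nhds_unique ((hM f hf).sub (hM g hg)) (h.mono_left hU))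

/-! ### Permanence properties of groups with invariant means. -/

/-- A group with a left-invariant mean. -/
def HasInvariantMean (G : Type*) [Group G] : Prop :=
  ∃ m : (G → ℝ) → ℝ, IsMean m ∧
    ∀ (g : G) (f : G → ℝ), IsBddFun f → m (fun h => f (g * h)) = m f

theorem HasInvariantMean.isAmenableGroup {G : Type*} [Group G] (h : HasInvariantMean G) :
    IsAmenableGroup G := by
  obtain ⟨m, hm, hinv⟩ := h
  refine ⟨fun A => m (A.indicator fun _ => 1), fun A => ⟨?_, ?_⟩, fun A B hAB => ?_, ?_,
    fun g A => ?_⟩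
  · rw [← hm.const 0]
    exact hm.mono (isBddFun_const _) (isBddFun_indicator _)
      fun y => Set.indicator_nonneg (fun _ _ => zero_le_one) y
  · conv_rhs => rw [← hm.const 1]
    exact hm.mono (isBddFun_indicator _) (isBddFun_const _)
      fun y => Set.indicator_le_self' (fun _ _ => zero_le_one) y
  · dsimp only
    rw [← hm.add (isBddFun_indicator _) (isBddFun_indicator _), Set.indicator_union_of_disjoint hAB]
  · simp only [Set.indicator_univ]
    exact hm.const 1
  · dsimp only
    rw [← hinv g _ (isBddFun_indicator (g • A))]
    congr 1
    funext y
    by_cases hy : y ∈ A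
    · rw [Set.indicator_of_mem hy, Set.indicator_of_mem]
      exact Set.smul_mem_smul_set hy
    · rw [Set.indicator_of_notMem hy, Set.indicator_of_notMem]
      intro h
      exact hy ((Set.smul_mem_smul_set_iff (a := g)).1 h)

/-- If `G` acts on `Z` with an invariant mean, the pairs `(g, z)` with `R g z` form a subgroupoid of
the action groupoid which contains `(g, z)` for almost all `z`, for every `g`, and the isotropy
groups of this subgroupoid have invariant means, then so has `G`. -/
theorem HasInvariantMean.of_groupoid {G Z : Type*} [Group G] (ρ : G →* Equiv.Perm Z)
    (R : G → Z → Prop) (R_one : ∀ z, R 1 z)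
    (R_mul : ∀ g h z, R h z → R g (ρ h z) → R (g * h) z)
    (R_inv : ∀ g z, R g z → R g⁻¹ (ρ g z))
    {m : (Z → ℝ) → ℝ} (hm : IsMean m)
    (hinv : ∀ (g : G) (f : Z → ℝ), IsBddFun f → m (fun z => f (ρ g z)) = m f)
    (hfull : ∀ (g : G) (f f' : Z → ℝ), IsBddFun f → IsBddFun f' →
      (∀ z, R g z → f z = f' z) → m f = m f')
    (hiso : ∀ (z : Z) (K : Subgroup G), (∀ k ∈ K, ρ k z = z ∧ R k z) → HasInvariantMean K) :
    HasInvariantMean G := by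
  have inv_apply : ∀ g z, ρ g⁻¹ (ρ g z) = z := fun g z => by simp
  let s : Setoid Z :=
    { r := fun z w => ∃ g, R g z ∧ ρ g z = w
      iseqv :=
        { refl := fun z => ⟨1, R_one z, by simp⟩
          symm := by
            rintro z _ ⟨g, hg, rfl⟩
            exact ⟨g⁻¹, R_inv g z hg, inv_apply g z⟩
          trans := by
            rintro z _ _ ⟨g, hg, rfl⟩ ⟨h, hh, rfl⟩
            exact ⟨h * g, R_mul h g z hg hh, by simp⟩ } }
  -- `o z` is a base point of the orbit of `z` under the subgroupoid, and `t z` will be an arrow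
  -- from `o z` to `z`.
  let o : Z → Z := fun z => (Quotient.mk s z).out
  have ho : ∀ g z, R g z → o (ρ g z) = o z := fun g z h =>
    congrArg Quotient.out (Quotient.sound (s := s) ⟨g, h, rfl⟩ :
      Quotient.mk s z = Quotient.mk s (ρ g z)).symm
  have ht : ∀ z, ∃ g, R g (o z) ∧ ρ g (o z) = z := fun z => Quotient.mk_out (s := s) z
  choose t htR ht using ht
  let K : Z → Subgroup G := fun z =>
    { carrier := {g | ρ g z = z ∧ R g z}
      one_mem' := ⟨by simp, R_one z⟩
      mul_mem' := by
        rintro a b ⟨ha, ha'⟩ ⟨hb, hb'⟩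
        exact ⟨by rw [map_mul, Equiv.Perm.mul_apply, hb, ha], R_mul a b z hb' (by rwa [hb])⟩
      inv_mem' := by
        rintro a ⟨ha, ha'⟩
        have h1 := inv_apply a z
        have h2 := R_inv a z ha'
        rw [ha] at h1 h2
        exact ⟨h1, h2⟩ }
  have hK := fun z => hiso z (K z) fun k hk => hk
  choose n hn hninv using hK
  -- The isotropy mean at the base point is transported along `t z`. Another arrow from `o z` to `z`
  -- differs from `t z` by an element of the isotropy group, so left invariance makes `μ z`
  -- independent of the choice; `key` is the resulting equivariance. Averaging `μ` over `m` gives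
  -- the mean on `G`.
  let μ : Z → (G → ℝ) → ℝ := fun z f => n (o z) fun k => f (t z * k)
  have hμ : ∀ z, IsMean (μ z) := fun z => (hn (o z)).comap fun k => t z * (k : G)
  have key : ∀ g z f, R g z → IsBddFun f → μ (ρ g z) f = μ z fun h => f (g * h) := by
    intro g z f hg hf
    have hk : (t z)⁻¹ * g⁻¹ * t (ρ g z) ∈ K (o z) := by
      have e1 : ρ (t (ρ g z)) (o z) = ρ g z := by rw [← ho g z hg]; exact ht _
      have r1 : R (t (ρ g z)) (o z) := by rw [← ho g z hg]; exact htR _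
      have r2 : R (t z)⁻¹ z := by
        have := R_inv (t z) (o z) (htR z)
        rwa [ht] at this
      have r3 : R ((t z)⁻¹ * g⁻¹) (ρ g z) :=
        R_mul _ _ _ (R_inv g z hg) (by rwa [inv_apply])
      refine ⟨?_, R_mul _ _ _ r1 (by rwa [e1])⟩
      rw [map_mul, Equiv.Perm.mul_apply, e1, map_mul, Equiv.Perm.mul_apply, inv_apply]
      have := inv_apply (t z) (o z)
      rwa [ht] at this
    have := hninv (o z) ⟨_, hk⟩ (fun k => f (g * (t z * k))) (hf.comp _)
    change n (o (ρ g z)) _ = n (o z) _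
    rw [← this]
    have e : ∀ w, w = o z → n w (fun k => f (t (ρ g z) * k)) =
        n (o z) (fun k => f (t (ρ g z) * k)) := by
      rintro w rfl
      rfl
    rw [e _ (ho g z hg)]
    congr 1
    funext k
    simp [mul_assoc]
  refine ⟨fun f => m fun z => μ z f, hm.bind hμ, fun g f hf => ?_⟩
  have hb : ∀ f : G → ℝ, IsBddFun f → IsBddFun fun z => μ z f := fun f ⟨C, hC⟩ =>
    ⟨C, fun z => (hμ z).abs_le hC⟩
  dsimp only
  rw [← hinv g _ (hb f hf)]
  exact hfull g _ _ (hb _ (hf.comp _)) ((hb f hf).comp _) fun z hz => (key g z f hz hf).symm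

theorem HasInvariantMean.of_finite (G : Type*) [Group G] [Finite G] : HasInvariantMean G := by
  have := Fintype.ofFinite G
  have hc : (0 : ℝ) < Fintype.card G := by exact_mod_cast Fintype.card_pos
  refine ⟨fun f => (∑ g, f g) / Fintype.card G, ⟨fun _ _ => ?_, fun _ _ h => ?_, fun c => ?_⟩,
    fun g f _ => ?_⟩
  · rw [Finset.sum_add_distrib, add_div]
  · exact div_le_div_of_nonneg_right (Finset.sum_le_sum fun i _ => h i) hc.le
  · rw [Finset.sum_const, Finset.card_univ, nsmul_eq_mul, mul_div_cancel_left₀ _ hc.ne']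
  · dsimp only
    rw [Fintype.sum_equiv (Equiv.mulLeft g) (fun h => f (g * h)) f fun _ => rfl]

/-- An action with an invariant mean whose point stabilizers have invariant means. -/
theorem HasInvariantMean.of_stabilizers {G Z : Type*} [Group G] (ρ : G →* Equiv.Perm Z)
    {m : (Z → ℝ) → ℝ} (hm : IsMean m)
    (hinv : ∀ (g : G) (f : Z → ℝ), IsBddFun f → m (fun z => f (ρ g z)) = m f)
    (hiso : ∀ (z : Z) (K : Subgroup G), (∀ k ∈ K, ρ k z = z) → HasInvariantMean K) :
    HasInvariantMean G :=
  .of_groupoid ρ (fun _ _ => True) (fun _ => trivial) (fun _ _ _ _ _ => trivial)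
    (fun _ _ _ => trivial) hm hinv
    (fun _ _ _ _ _ h => congrArg m (funext fun z => h z trivial))
    fun z K hK => hiso z K fun k hk => (hK k hk).1

/-- An extension of groups with invariant means. -/
theorem HasInvariantMean.of_ker {G H : Type*} [Group G] [Group H] (φ : G →* H)
    (hH : HasInvariantMean H)
    (hker : ∀ K : Subgroup G, (∀ k ∈ K, φ k = 1) → HasInvariantMean K) :
    HasInvariantMean G := by
  obtain ⟨m, hm, hinv⟩ := hH
  refine .of_stabilizers ((MulAction.toPermHom H H).comp φ) hm (fun g f hf => hinv _ f hf)
    fun z K hK => hker K fun k hk => ?_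
  have := hK k hk
  simpa using this

theorem HasInvariantMean.of_injective {G H : Type*} [Group G] [Group H] (φ : G →* H)
    (hφ : Function.Injective φ) (hH : HasInvariantMean H) : HasInvariantMean G := by
  refine .of_ker φ hH fun K hK => ?_
  have : Subsingleton K := ⟨fun a b => Subtype.ext (hφ ((hK a a.2).trans (hK b b.2).symm))⟩
  exact .of_finite K

theorem HasInvariantMean.pi {H : Type*} [Group H] (hH : HasInvariantMean H) (ι : Type*)
    [Finite ι] : HasInvariantMean (ι → H) := by
  induction ι using Finite.induction_empty_option with
  | of_equiv e h =>
    refine .of_injective (MonoidHom.mk' (fun f i => f (e i)) fun _ _ => rfl) (fun f g hfg => ?_) h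
    funext i
    simpa using congrFun hfg (e.symm i)
  | h_empty => exact .of_finite _
  | h_option h =>
    refine .of_ker (Pi.evalMonoidHom (fun _ => H) none) hH fun K hK => ?_
    refine .of_injective (MonoidHom.mk' (fun f i => f.1 (some i)) fun _ _ => rfl)
      (fun f g hfg => ?_) h
    refine Subtype.ext (funext fun i => ?_)
    cases i with
    | none => exact (hK f f.2).trans (hK g g.2).symm
    | some i => exact congrFun hfg i

/-- A group exhausted by a sequence of subgroups with invariant means. -/
theorem HasInvariantMean.of_eventually_mem {G : Type*} [Group G] (K : ℕ → Subgroup G)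
    (hK : ∀ᶠ n in Filter.atTop, HasInvariantMean (K n))
    (hmem : ∀ g, ∀ᶠ n in Filter.atTop, g ∈ K n) : HasInvariantMean G := by
  have h : ∀ n, ∃ m : (K n → ℝ) → ℝ, IsMean m ∧ (HasInvariantMean (K n) →
      ∀ (g : K n) (f : K n → ℝ), IsBddFun f → m (fun h => f (g * h)) = m f) := by
    intro n
    by_cases h : HasInvariantMean (K n)
    · obtain ⟨m, hm, hi⟩ := h
      exact ⟨m, hm, fun _ => hi⟩
    -- An arbitrary mean for the indices where no invariant one is available; these are eventually
    -- absent.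
    · exact ⟨fun f => f 1, ⟨fun _ _ => rfl, fun _ _ h => h 1, fun _ => rfl⟩, fun h' => absurd h' h⟩
  choose m hm hi using h
  obtain ⟨M, hM, hlim⟩ := exists_limit_mean Filter.atTop
    (fun n (f : G → ℝ) => m n fun k => f k) fun n => (hm n).comap _
  refine ⟨M, hM, fun g f hf => hlim _ _ (hf.comp _) hf ?_⟩
  refine tendsto_const_nhds.congr' ?_
  filter_upwards [hK, hmem g] with n hn hg
  exact (sub_eq_zero.2 (hi n hn ⟨g, hg⟩ (fun k => f k) (hf.comp _))).symm

/-- Passing to the pointwise stabilizer of an invariant finite set. -/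
theorem HasInvariantMean.of_fix_finite {G Y : Type*} [Group G] (ρ : G →* Equiv.Perm Y)
    (p : Y → Prop) [Finite {y // p y}] (hp : ∀ g y, p (ρ g y) ↔ p y)
    (hfix : ∀ K : Subgroup G, (∀ k ∈ K, ∀ y, p y → ρ k y = y) → HasInvariantMean K) :
    HasInvariantMean G := by
  refine .of_ker (MonoidHom.mk' (fun g => (ρ g).subtypePerm (p := p) (hp g)) fun a b => ?_)
    (.of_finite (Equiv.Perm {y // p y})) fun K hK => hfix K fun k hk y hy => ?_
  · ext y
    exact congrArg (fun e : Equiv.Perm Y => e y) (map_mul ρ a b)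
  · have := congrArg (fun e : Equiv.Perm {y // p y} => (e ⟨y, hy⟩ : Y)) (hK k hk)
    simpa using this

/-! ### Infinite words and the action on the boundary of the tree -/

namespace InfWord

variable {X : Type*}

/-- The prefix of length `n` of an infinite word. -/
def pre (y : ℕ → X) (n : ℕ) : List X := (List.range n).map y

/-- The infinite word obtained by removing the first `n` letters. -/
def drop (n : ℕ) (y : ℕ → X) : ℕ → X := fun i => y (n + i)

/-- The infinite word obtained by prepending a finite word. -/
def append : List X → (ℕ → X) → ℕ → X
  | [], y => y
  | x :: v, y => fun n => Nat.casesOn n x (append v y)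

@[simp] theorem length_pre (y : ℕ → X) (n : ℕ) : (pre y n).length = n := by simp [pre]

@[simp] theorem pre_zero (y : ℕ → X) : pre y 0 = [] := rfl

theorem pre_one (y : ℕ → X) : pre y 1 = [y 0] := rfl

@[simp] theorem drop_zero (y : ℕ → X) : drop 0 y = y := funext fun i => by simp [drop]

theorem drop_drop (m n : ℕ) (y : ℕ → X) : drop m (drop n y) = drop (n + m) y :=
  funext fun i => by simp [drop, add_assoc]

theorem pre_add (y : ℕ → X) (m n : ℕ) : pre y (m + n) = pre y m ++ pre (drop m y) n := by
  simp [pre, List.range_add, drop, Function.comp_def]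

theorem ext_pre {y z : ℕ → X} (h : ∀ n, pre y n = pre z n) : y = z := by
  funext n
  have := congrArg (fun l => l[n]?) (h (n + 1))
  simpa [pre] using this

theorem pre_eq_of_le {y z : ℕ → X} {m n : ℕ} (hmn : m ≤ n) (h : pre y n = pre z n) :
    pre y m = pre z m := by
  obtain ⟨k, rfl⟩ := Nat.exists_eq_add_of_le hmn
  rw [pre_add, pre_add] at h
  exact (List.append_inj h (by simp)).1

theorem eq_of_pre_of_drop {y z : ℕ → X} (n : ℕ) (h : pre y n = pre z n)
    (h' : drop n y = drop n z) : y = z := by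
  funext i
  rcases lt_or_ge i n with hi | hi
  · have := congrArg (fun l => l[i]?) h
    simpa [pre, hi] using this
  · obtain ⟨k, rfl⟩ := Nat.exists_eq_add_of_le hi
    exact congrFun h' k

theorem drop_append (v : List X) (y : ℕ → X) : drop v.length (append v y) = y := by
  induction v with
  | nil => simp [append]
  | cons x v ih =>
    rw [List.length_cons, add_comm, ← drop_drop]
    conv_rhs => rw [← ih]
    congr 1
    funext i
    simp [drop, append, add_comm 1]

theorem pre_append (v : List X) (y : ℕ → X) : pre (append v y) v.length = v := by
  induction v with
  | nil => rfl
  | cons x v ih =>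
    rw [List.length_cons, add_comm, pre_add, pre_one]
    have : drop 1 (append (x :: v) y) = append v y := by
      funext i
      simp [drop, append, add_comm 1]
    rw [this, ih]
    rfl

theorem append_pre_drop (n : ℕ) (y : ℕ → X) : append (pre y n) (drop n y) = y := by
  have h1 := pre_append (pre y n) (drop n y)
  have h2 := drop_append (pre y n) (drop n y)
  rw [length_pre] at h1 h2
  exact eq_of_pre_of_drop n h1 h2

/-- Finitely many distinct infinite words are separated by prefixes. -/
theorem exists_injOn_pre (s : Finset (ℕ → X)) : ∃ n, ∀ m ≥ n,
    Set.InjOn (fun y => pre y m) (s : Set (ℕ → X)) := by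
  have h : ∀ y z : ℕ → X, ∃ n, pre y n = pre z n → y = z := by
    intro y z
    by_contra! h
    exact (h 0).2 (ext_pre fun n => (h n).1)
  choose k hk using h
  refine ⟨s.sup fun y => s.sup fun z => k y z, fun m hm y hy z hz hyz => hk y z ?_⟩
  refine pre_eq_of_le (le_trans ?_ hm) hyz
  exact (Finset.le_sup (f := fun z => k y z) hz).trans
    (Finset.le_sup (f := fun y => s.sup fun z => k y z) hy)

end InfWord

/-! ### Sections along infinite words and singular sets. -/

namespace treeAut

open InfWord

variable {X : Type*}

theorem sectionAt_append (g : treeAut X) (v w : List X) :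
    sectionAt g (v ++ w) = sectionAt (sectionAt g v) w := by
  refine (eq_sectionAt g _ (v ++ w) fun u => ?_).symm
  rw [List.append_assoc, apply_append, apply_append (sectionAt g v), apply_append,
    List.append_assoc]

theorem apply_nil (g : treeAut X) : g.1 [] = [] := g.2

theorem sectionAt_nil (g : treeAut X) : sectionAt g [] = g :=
  (eq_sectionAt g g [] fun w => by rw [apply_nil]; rfl).symm

theorem inv_sectionAt (g : treeAut X) (v : List X) :
    (sectionAt g v)⁻¹ = sectionAt g⁻¹ (g.1 v) := by
  rw [sectionAt_inv, inv_apply_self]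

/-- The action of a tree automorphism on infinite words. -/
def act (g : treeAut X) (y : ℕ → X) : ℕ → X := fun i =>
  (g.1 (pre y (i + 1)))[i]'(by rw [length_apply, length_pre]; exact i.lt_succ_self)

theorem pre_act (g : treeAut X) (y : ℕ → X) (n : ℕ) : pre (act g y) n = g.1 (pre y n) := by
  refine List.ext_getElem (by rw [length_apply, length_pre, length_pre]) fun i hi hi' => ?_
  have hin : i + 1 ≤ n := by simpa using hi
  obtain ⟨k, rfl⟩ := Nat.exists_eq_add_of_le hin
  have h := apply_append g (pre y (i + 1)) (pre (drop (i + 1) y) k)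
  rw [← pre_add] at h
  simp only [h]
  rw [List.getElem_append_left (by rw [length_apply, length_pre]; exact i.lt_succ_self)]
  simp [pre, act]

theorem act_one (y : ℕ → X) : act 1 y = y := ext_pre fun n => by rw [pre_act, one_apply]

theorem act_mul (g h : treeAut X) (y : ℕ → X) : act (g * h) y = act g (act h y) :=
  ext_pre fun n => by rw [pre_act, pre_act, pre_act, mul_apply]

theorem act_inv_act (g : treeAut X) (y : ℕ → X) : act g⁻¹ (act g y) = y := by
  rw [← act_mul, inv_mul_cancel, act_one]

theorem act_act_inv (g : treeAut X) (y : ℕ → X) : act g (act g⁻¹ y) = y := by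
  rw [← act_mul, mul_inv_cancel, act_one]

theorem drop_act (g : treeAut X) (n : ℕ) (y : ℕ → X) :
    drop n (act g y) = act (sectionAt g (pre y n)) (drop n y) := by
  refine ext_pre fun m => ?_
  have h := pre_act g y (n + m)
  rw [pre_add, pre_add, apply_append, pre_act] at h
  rw [pre_act]
  exact List.append_cancel_left h

/-- The permutation representation on infinite words. -/
def actHom (X : Type*) : treeAut X →* Equiv.Perm (ℕ → X) where
  toFun g := ⟨act g, act g⁻¹, act_inv_act g, act_act_inv g⟩
  map_one' := Equiv.ext act_one
  map_mul' g h := Equiv.ext (act_mul g h)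

@[simp] theorem actHom_apply (g : treeAut X) (y : ℕ → X) : actHom X g y = act g y := rfl

/-- The permutation representation on finite words. -/
def wordHom (X : Type*) : treeAut X →* Equiv.Perm (List X) where
  toFun g := g.1.toEquiv
  map_one' := rfl
  map_mul' _ _ := rfl

@[simp] theorem wordHom_apply (g : treeAut X) (v : List X) : wordHom X g v = g.1 v := rfl

/-- The set of infinite words along which no section of `g` belongs to `P`. -/
def singularSet (P : Subgroup (treeAut X)) (g : treeAut X) : Set (ℕ → X) :=
  {y | ∀ n, sectionAt g (pre y n) ∉ P}

/-- A subgroup is closed under sections. -/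
def IsSectionClosed (P : Subgroup (treeAut X)) : Prop := ∀ g ∈ P, ∀ v, sectionAt g v ∈ P

theorem sectionAt_pre_add (g : treeAut X) (y : ℕ → X) (m n : ℕ) :
    sectionAt g (pre y (m + n)) = sectionAt (sectionAt g (pre y m)) (pre (drop m y) n) := by
  rw [pre_add, sectionAt_append]

theorem sectionAt_pre_mem_of_le {P : Subgroup (treeAut X)} (hP : IsSectionClosed P)
    {g : treeAut X} {y : ℕ → X} {m n : ℕ} (hmn : m ≤ n) (h : sectionAt g (pre y m) ∈ P) :
    sectionAt g (pre y n) ∈ P := by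
  obtain ⟨k, rfl⟩ := Nat.exists_eq_add_of_le hmn
  rw [sectionAt_pre_add]
  exact hP _ h _

theorem drop_mem_singularSet_sectionAt {P : Subgroup (treeAut X)} {g : treeAut X} {y : ℕ → X}
    (hy : y ∈ singularSet P g) (n : ℕ) :
    drop n y ∈ singularSet P (sectionAt g (pre y n)) := fun m => by
  rw [← sectionAt_pre_add]
  exact hy _

theorem mem_singularSet_of_drop {P : Subgroup (treeAut X)} (hP : IsSectionClosed P)
    {g : treeAut X} {y : ℕ → X} {n : ℕ}
    (hy : drop n y ∈ singularSet P (sectionAt g (pre y n))) : y ∈ singularSet P g := fun m hm => by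
  refine hy m ?_
  rw [← sectionAt_pre_add]
  exact sectionAt_pre_mem_of_le hP (Nat.le_add_left m n) hm

theorem append_mem_singularSet {P : Subgroup (treeAut X)} (hP : IsSectionClosed P)
    {g : treeAut X} {v : List X} {y : ℕ → X} :
    append v y ∈ singularSet P g ↔ y ∈ singularSet P (sectionAt g v) := by
  have h1 := pre_append v y
  have h2 := drop_append v y
  constructor
  · intro h
    have := drop_mem_singularSet_sectionAt h v.length
    rwa [h1, h2] at this
  · intro h
    refine mem_singularSet_of_drop hP (n := v.length) ?_
    rwa [h1, h2]

theorem singularSet_one (P : Subgroup (treeAut X)) : singularSet P 1 = ∅ :=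
  Set.eq_empty_of_forall_notMem fun y hy => hy 0 (by rw [sectionAt_one]; exact P.one_mem)

/-- This cocycle inclusion is what makes the condition that `A` contains the singular set closed
under composition in the action groupoid. -/
theorem singularSet_mul {P : Subgroup (treeAut X)} (hP : IsSectionClosed P) {g h : treeAut X}
    {y : ℕ → X} (hy : y ∈ singularSet P (g * h)) :
    y ∈ singularSet P h ∨ act h y ∈ singularSet P g := by
  by_contra! hc
  obtain ⟨h1, h2⟩ := hc
  simp only [singularSet, Set.mem_ofPred_eq, not_forall, not_not] at h1 h2
  obtain ⟨m, hm⟩ := h1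
  obtain ⟨n, hn⟩ := h2
  refine hy (max m n) ?_
  rw [sectionAt_mul, ← pre_act]
  exact P.mul_mem (sectionAt_pre_mem_of_le hP (le_max_right m n) hn)
    (sectionAt_pre_mem_of_le hP (le_max_left m n) hm)

theorem act_mem_singularSet_inv {P : Subgroup (treeAut X)} {g : treeAut X}
    {y : ℕ → X} : act g y ∈ singularSet P g⁻¹ ↔ y ∈ singularSet P g := by
  refine forall_congr' fun n => ?_
  rw [pre_act, ← inv_sectionAt, P.inv_mem_iff]

/-- If membership in `P` can be tested on the first level, then an element outside `P` has a
singular point. -/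
theorem singularSet_nonempty {P G : Subgroup (treeAut X)} (hG : IsSectionClosed G)
    (hsat : ∀ g ∈ G, (∀ x, sectionAt g [x] ∈ P) → g ∈ P) {g : treeAut X} (hg : g ∈ G)
    (hgP : g ∉ P) : (singularSet P g).Nonempty := by
  have step : ∀ s : {s // s ∈ G ∧ s ∉ P}, ∃ x, sectionAt s.1 [x] ∉ P := fun s => by
    by_contra! h
    exact s.2.2 (hsat s.1 s.2.1 h)
  choose x hx using step
  let next : {s // s ∈ G ∧ s ∉ P} → {s // s ∈ G ∧ s ∉ P} := fun s =>
    ⟨sectionAt s.1 [x s], hG _ s.2.1 _, hx s⟩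
  let seq : ℕ → {s // s ∈ G ∧ s ∉ P} := fun n => next^[n] ⟨g, hg, hgP⟩
  refine ⟨fun n => x (seq n), fun n => ?_⟩
  suffices h : sectionAt g (pre (fun n => x (seq n)) n) = (seq n).1 by
    rw [h]
    exact (seq n).2.2
  induction n with
  | zero => exact sectionAt_nil g
  | succ n ih =>
    rw [sectionAt_pre_add, ih, pre_one]
    change _ = (next^[n + 1] _).1
    rw [Function.iterate_succ_apply']
    rfl

theorem IsFiniteState.sectionAt {g : treeAut X} (hg : IsFiniteState g) (v : List X) :
    IsFiniteState (sectionAt g v) :=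
  Set.Finite.subset hg <| by
    rintro _ ⟨w, rfl⟩
    exact ⟨v ++ w, sectionAt_append g v w⟩

end treeAut

/-! ### The induction step -/

open Filter in
/-- An eventually periodic orbit is eventually invariant under every sufficiently divisible
shift. -/
theorem eventually_iterate_add_factorial {α : Type*} (f : α → α) (x : α)
    (h : (Set.range fun n => f^[n] x).Finite) :
    ∀ᶠ N in atTop, f^[N + N.factorial] x = f^[N] x := by
  have hinj : ¬ Function.Injective fun n => f^[n] x := fun hi => Set.infinite_range_of_injective hi h
  -- `m` is a preperiod and `l` a period; `l` divides `N!` as soon as `N ≥ l`.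
  obtain ⟨m, l, hl, hml⟩ : ∃ m l, 0 < l ∧ f^[m + l] x = f^[m] x := by
    simp only [Function.Injective, not_forall] at hinj
    obtain ⟨a, b, hab, hne⟩ := hinj
    rcases Nat.lt_or_gt_of_ne hne with h | h
    · exact ⟨a, b - a, by omega, by rw [Nat.add_sub_cancel' h.le]; exact hab.symm⟩
    · exact ⟨b, a - b, by omega, by rw [Nat.add_sub_cancel' h.le]; exact hab⟩
  have hper : ∀ j n, m ≤ n → f^[n + l * j] x = f^[n] x := by
    intro j n hn
    obtain ⟨k, rfl⟩ := Nat.exists_eq_add_of_le hn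
    induction j with
    | zero => rfl
    | succ j ih =>
      rw [show m + k + l * (j + 1) = (k + l * j) + (m + l) by ring, Function.iterate_add_apply, hml,
        ← Function.iterate_add_apply, show k + l * j + m = m + k + l * j by ring, ih]
  filter_upwards [eventually_ge_atTop m, eventually_ge_atTop l] with N hm hN
  obtain ⟨j, hj⟩ := Nat.dvd_factorial hl hN
  rw [hj, hper j N hm]

namespace treeAut

open InfWord

/-- Sufficient conditions for the amenability of `P` to imply the amenability of `G`, given a mean
concentrated on finite sets of infinite words that contain the singular sets. -/
structure IsFinitelySingularOver {X : Type*} (G P : Subgroup (treeAut X)) : Prop where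
  isSectionClosed_left : IsSectionClosed G
  isSectionClosed_right : IsSectionClosed P
  isFiniteState : ∀ g ∈ G, IsFiniteState g
  finite_singularSet : ∀ g ∈ G, (singularSet P g).Finite
  mem_of_forall_letter : ∀ g ∈ G, (∀ x, sectionAt g [x] ∈ P) → g ∈ P

universe u

variable {X : Type u} {G P : Subgroup (treeAut X)}

/-- Since `h` is its own section at the period, prepending the period is an injective self-map of
the singular set. That set is finite, so the map is surjective: every singular point begins with the
period, and then with all its powers. -/
theorem IsFinitelySingularOver.eq_of_mem_singularSet (H : IsFinitelySingularOver G P)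
    {h : treeAut X} (hG : h ∈ G) {b : ℕ → X} {l : ℕ} (hl : 0 < l) (hb : drop l b = b)
    (hh : sectionAt h (pre b l) = h) {c : ℕ → X} (hc : c ∈ singularSet P h) : c = b := by
  have hmem : ∀ c ∈ singularSet P h, append (pre b l) c ∈ singularSet P h := fun c hc => by
    rwa [append_mem_singularSet H.isSectionClosed_right, hh]
  have hfin : Finite (singularSet P h) := H.finite_singularSet h hG
  let f : singularSet P h → singularSet P h := fun c => ⟨append (pre b l) c, hmem c c.2⟩
  have hf : Function.Injective f := fun c d hcd => by
    have := congrArg (drop (pre b l).length) (congrArg Subtype.val hcd)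
    simp only [f, drop_append] at this
    exact Subtype.ext this
  have hsurj := Finite.injective_iff_surjective.1 hf
  have key : ∀ k, ∀ c ∈ singularSet P h, pre c (k * l) = pre b (k * l) := by
    intro k
    induction k with
    | zero => simp
    | succ k ih =>
      intro c hc
      obtain ⟨c', hc'⟩ := hsurj ⟨c, hc⟩
      have hcc : c = append (pre b l) c' := (congrArg Subtype.val hc').symm
      have h1 := pre_append (pre b l) c'
      have h2 := drop_append (pre b l) c'
      rw [length_pre, ← hcc] at h1 h2
      rw [add_mul, one_mul, add_comm, pre_add, pre_add, h1, h2, hb, ih c' c'.2]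
  exact ext_pre fun n => pre_eq_of_le (Nat.le_mul_of_pos_right n hl) (key n c hc)

/-- The group of elements of `G` that coincide with their section at a period of a periodic infinite
word which they fix. -/
theorem IsFinitelySingularOver.hasInvariantMean_of_selfSimilar [Finite X]
    (H : IsFinitelySingularOver G P) (hP : HasInvariantMean P) {K : Type*} [Group K]
    (φ : K →* treeAut X) (hφ : Function.Injective φ) (hφG : ∀ k, φ k ∈ G) (b : ℕ → X) {l : ℕ}
    (hl : 0 < l) (hb : drop l b = b) (hK : ∀ k, sectionAt (φ k) (pre b l) = φ k) :
    HasInvariantMean K := by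
  have hfin : Finite {v : List X // v.length = l} := List.finite_length_eq X l
  refine .of_fix_finite ((wordHom X).comp φ) (fun v => v.length = l)
    (fun g v => by simp [length_apply]) fun K₀ hK₀ => ?_
  have hfix : ∀ k ∈ K₀, ∀ v : List X, v.length = l → (φ k).1 v = v := hK₀
  let ι := {v : List X // v.length = l ∧ v ≠ pre b l}
  have : Finite ι := Set.Finite.subset hfin fun v (hv : v.length = l ∧ _) => hv.1
  -- The only possible singular point is `b`, so a section at another word of length `l` cannot lie
  -- outside `P`.
  have hoff : ∀ k, ∀ v : ι, sectionAt (φ k) v ∈ P := by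
    rintro k ⟨v, hv, hne⟩
    by_contra hP'
    obtain ⟨y, hy⟩ := singularSet_nonempty H.isSectionClosed_left H.mem_of_forall_letter
      (H.isSectionClosed_left _ (hφG k) v) hP'
    rw [← append_mem_singularSet H.isSectionClosed_right] at hy
    have := H.eq_of_mem_singularSet (hφG k) hl hb (hK k) hy
    refine hne ?_
    rw [← this, ← hv, pre_append]
  refine .of_injective (H := ι → P) (MonoidHom.mk' (fun k v => ⟨sectionAt (φ k) v, hoff k v⟩)
    fun a b => ?_) ((injective_iff_map_eq_one _).2 fun k hk => ?_) (hP.pi ι)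
  · refine funext fun v => Subtype.ext ?_
    change sectionAt (φ (a * b : K₀)) v = sectionAt (φ a) v * sectionAt (φ b) v
    rw [Subgroup.coe_mul, map_mul, sectionAt_mul, hfix b b.2 v v.2.1]
  · have hk' : ∀ v : List X, v.length = l → v ≠ pre b l → sectionAt (φ k) v = 1 := fun v h1 h2 =>
      congrArg Subtype.val (congrFun hk ⟨v, h1, h2⟩)
    refine Subtype.ext (hφ ?_)
    rw [Subgroup.coe_one, map_one]
    -- An element fixing level `l` with trivial sections off the period is trivial: along the period
    -- the section is the element itself, so induction on the length of the word applies.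
    refine ext' fun w => ?_
    rw [one_apply]
    induction hn : w.length using Nat.strong_induction_on generalizing w with
    | _ n ih =>
      rcases lt_or_ge n l with hnl | hnl
      · have h1 := hfix k k.2 (w ++ pre b (l - n)) (by rw [List.length_append, length_pre]; omega)
        rw [apply_append] at h1
        exact (List.append_inj h1 (length_apply _ _)).1
      · have ht : (w.take l).length = l := by rw [List.length_take]; omega
        conv_lhs => rw [← List.take_append_drop l w]
        rw [apply_append, hfix k k.2 _ ht]
        by_cases hp : w.take l = pre b l
        · rw [hp, hK, ih _ (by rw [← hn, List.length_drop]; omega) (w.drop l) rfl, ← hp,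
            List.take_append_drop]
        · rw [hk' _ ht hp, one_apply, List.take_append_drop]

theorem iterate_drop (n : ℕ) (y : ℕ → X) : (drop 1)^[n] y = drop n y := by
  induction n with
  | zero => simp
  | succ n ih => rw [Function.iterate_succ_apply', ih, drop_drop]

theorem iterate_sectionAt (n : ℕ) (g : treeAut X) (y : ℕ → X) :
    (fun s : treeAut X × (ℕ → X) => (sectionAt s.1 (pre s.2 1), drop 1 s.2))^[n] (g, y) =
      (sectionAt g (pre y n), drop n y) := by
  induction n with
  | zero => simp [sectionAt_nil]
  | succ n ih => rw [Function.iterate_succ_apply', ih, drop_drop, ← sectionAt_pre_add]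

/-- Induction on `A`, over all groups embedded in `G` at once because the group changes in the
induction. With no allowed singular points the group lies in `P`; otherwise one point `a` is made
nonsingular at a time. -/
theorem IsFinitelySingularOver.hasInvariantMean_of_fix [Finite X]
    (H : IsFinitelySingularOver G P) (hP : HasInvariantMean P) (A : Finset (ℕ → X)) :
    ∀ (K : Type u) [Group K] (φ : K →* treeAut X), Function.Injective φ → (∀ k, φ k ∈ G) →
      (∀ k, ∀ a ∈ A, act (φ k) a = a) → (∀ k, singularSet P (φ k) ⊆ A) →
      HasInvariantMean K := by
  classical
  induction A using Finset.induction_on with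
  | empty =>
    intro K _ φ hφ hφG _ hS
    refine .of_injective (φ.codRestrict P fun k => ?_) (fun a b hab => hφ ?_) hP
    · by_contra hk
      obtain ⟨y, hy⟩ := singularSet_nonempty H.isSectionClosed_left H.mem_of_forall_letter
        (hφG k) hk
      simpa using hS k hy
    · exact congrArg Subtype.val hab
  | insert a A _ ih =>
    intro K _ φ hφ hφG hfix hS
    have hfixA : ∀ k, ∀ b ∈ A, act (φ k) b = b := fun k b hb =>
      hfix k b (Finset.mem_insert_of_mem hb)
    have hSA : ∀ k, a ∉ singularSet P (φ k) → singularSet P (φ k) ⊆ A := by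
      intro k hk y hy
      rcases Finset.mem_insert.1 (hS k hy) with rfl | h
      · exact absurd hy hk
      · exact h
    by_cases hfin : (Set.range fun n => drop n a).Finite
    swap
    -- If `a` were singular for `φ k`, all its tails would be singular for sections of `φ k`; there
    -- are finitely many sections, each with finitely many singular points.
    · refine ih K φ hφ hφG hfixA fun k => hSA k fun hk => hfin ?_
      have hs : (⋃ s ∈ Set.range (sectionAt (φ k)), singularSet P s).Finite :=
        (H.isFiniteState _ (hφG k)).biUnion (by
          rintro _ ⟨v, rfl⟩
          exact H.finite_singularSet _ (H.isSectionClosed_left _ (hφG k) v))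
      refine hs.subset ?_
      rintro _ ⟨n, rfl⟩
      exact Set.mem_biUnion ⟨_, rfl⟩ (drop_mem_singularSet_sectionAt hk n)
    have hpre : ∀ k n, (φ k).1 (pre a n) = pre a n := fun k n => by
      rw [← pre_act, hfix k a (Finset.mem_insert_self _ _)]
    let sec : ℕ → K →* treeAut X := fun n => MonoidHom.mk' (fun k => sectionAt (φ k) (pre a n))
      fun g h => by rw [map_mul, sectionAt_mul, hpre]
    have hsec : ∀ n k, sec n k = sectionAt (φ k) (pre a n) := fun _ _ => rfl
    -- As `a` is fixed, taking sections along it is a homomorphism. The pair consisting of section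
    -- and tail has a finite orbit for each `k`, so every `k` eventually lies in the subgroup where
    -- the sections at depths `N` and `N + N!` agree. On that subgroup the image of `sec N` is
    -- self-similar along the periodic tail `drop N a`, and on the kernel `a` is no longer singular.
    refine .of_eventually_mem (fun N => (sec (N + N.factorial)).eqLocus (sec N)) ?_ fun k => ?_
    · have := eventually_iterate_add_factorial (drop 1) a (by simpa only [iterate_drop] using hfin)
      filter_upwards [this] with N hN
      rw [iterate_drop, iterate_drop] at hN
      let KN := (sec (N + N.factorial)).eqLocus (sec N)
      refine HasInvariantMean.of_ker ((sec N).comp KN.subtype).rangeRestrict ?_ fun K' hK' => ?_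
      · refine H.hasInvariantMean_of_selfSimilar hP (Subgroup.subtype _)
          (Subgroup.subtype_injective _) ?_ (drop N a) N.factorial_pos (by rw [drop_drop, hN]) ?_
        · rintro ⟨_, k, rfl⟩
          exact H.isSectionClosed_left _ (hφG k) _
        · rintro ⟨_, k, rfl⟩
          change sectionAt (sectionAt (φ k) (pre a N)) _ = sectionAt (φ k) (pre a N)
          rw [← sectionAt_pre_add]
          exact k.2
      · refine ih K' (φ.comp (KN.subtype.comp K'.subtype))
          (hφ.comp ((Subgroup.subtype_injective _).comp (Subgroup.subtype_injective _)))
          (fun k => hφG _) (fun k => hfixA _) fun k => hSA _ fun hk => hk N ?_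
        have : sec N k = 1 := congrArg Subtype.val (hK' k k.2)
        change sec N k ∈ P
        rw [this]
        exact P.one_mem
    · have hr : (Set.range fun n => (fun s : treeAut X × (ℕ → X) =>
          (sectionAt s.1 (pre s.2 1), drop 1 s.2))^[n] (φ k, a)).Finite := by
        refine ((H.isFiniteState _ (hφG k)).prod hfin).subset ?_
        rintro _ ⟨n, rfl⟩
        simp only [iterate_sectionAt]
        exact ⟨⟨_, rfl⟩, ⟨_, rfl⟩⟩
      filter_upwards [eventually_iterate_add_factorial _ _ hr] with N hN
      rw [iterate_sectionAt, iterate_sectionAt] at hN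
      exact congrArg Prod.fst hN

/-! ### Passing from `P` to `G` by a mean on finite sets of infinite words. -/

/-- The permutation representation on finite sets of infinite words. -/
def finsetHom (X : Type*) : treeAut X →* Equiv.Perm (Finset (ℕ → X)) where
  toFun g := (actHom X g).finsetCongr
  map_one' := by
    ext A y
    simp only [map_one, Equiv.finsetCongr_apply, Finset.mem_map_equiv]
    rfl
  map_mul' g h := by
    ext A y
    simp only [map_mul, Equiv.finsetCongr_apply, Finset.mem_map_equiv, Equiv.Perm.mul_apply]
    rfl

theorem act_mem_finsetHom (g : treeAut X) (A : Finset (ℕ → X)) (y : ℕ → X) :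
    act g y ∈ finsetHom X g A ↔ y ∈ A := by
  change actHom X g y ∈ A.map (actHom X g).toEmbedding ↔ _
  rw [Finset.mem_map_equiv, Equiv.symm_apply_apply]

/-- The subgroupoid consists of the pairs `(g, A)` for which `A` contains the singular set of `g`.
An isotropy group at `A` permutes the finite set `A`, so the pointwise stabilizer suffices. -/
theorem IsFinitelySingularOver.hasInvariantMean [Finite X]
    (H : IsFinitelySingularOver G P) (hP : HasInvariantMean P)
    {m : (Finset (ℕ → X) → ℝ) → ℝ} (hm : IsMean m)
    (hinv : ∀ g ∈ G, ∀ f : Finset (ℕ → X) → ℝ, IsBddFun f →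
      m (fun A => f (finsetHom X g A)) = m f)
    (hfull : ∀ g ∈ G, ∀ f f' : Finset (ℕ → X) → ℝ, IsBddFun f → IsBddFun f' →
      (∀ A : Finset (ℕ → X), singularSet P g ⊆ A → f A = f' A) → m f = m f') :
    HasInvariantMean G := by
  refine .of_groupoid ((finsetHom X).comp G.subtype)
    (fun g A => singularSet P (g : treeAut X) ⊆ A) ?_ ?_ ?_ hm (fun g => hinv g g.2)
    (fun g => hfull g g.2) fun A K hK => ?_
  · intro A
    rw [Subgroup.coe_one, singularSet_one]
    exact Set.empty_subset _
  · intro g h A hh hg y hy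
    rcases singularSet_mul H.isSectionClosed_right hy with hy | hy
    · exact hh hy
    · exact (act_mem_finsetHom (h : treeAut X) A y).1 (hg hy)
  · intro g A hg y hy
    have e := act_act_inv (g : treeAut X) y
    rw [Subgroup.coe_inv, ← e, act_mem_singularSet_inv] at hy
    rw [← e]
    exact (act_mem_finsetHom (g : treeAut X) A _).2 (hg hy)
  · refine .of_fix_finite ((actHom X).comp (G.subtype.comp K.subtype)) (· ∈ A) (fun k y => ?_)
      fun K₀ hK₀ => ?_
    · have := act_mem_finsetHom (k : treeAut X) A y
      rwa [show finsetHom X (k : treeAut X) A = A from (hK k k.2).1] at this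
    · exact H.hasInvariantMean_of_fix hP A K₀ (G.subtype.comp (K.subtype.comp K₀.subtype))
        ((Subgroup.subtype_injective _).comp ((Subgroup.subtype_injective _).comp
          (Subgroup.subtype_injective _))) (fun k => k.1.1.2) (fun k a ha => hK₀ k k.2 a ha)
        fun k => (hK k.1 k.1.2).2

end treeAut

/-! ### Almost invariant measures on finite subsets -/

section BernoulliVector

variable {Y : Type*} [DecidableEq Y]

/-- The square root of the law of the random subset of `U` that contains each `y` independently with
probability `sin² (π / 2 * a y)`. -/
noncomputable def bernoulliVector (a : Y → ℝ) (U A : Finset Y) : ℝ :=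
  (∏ y ∈ A, Real.sin (Real.pi / 2 * a y)) * ∏ y ∈ U \ A, Real.cos (Real.pi / 2 * a y)

/-- The expectation with respect to the law of the random subset of `U` that contains each `y`
independently with probability `sin² (π / 2 * a y)`. -/
noncomputable def bernoulliMean (a : Y → ℝ) (U : Finset Y) (f : Finset Y → ℝ) : ℝ :=
  ∑ A ∈ U.powerset, bernoulliVector a U A ^ 2 * f A

/-- The angle parametrization by sine and cosine is chosen so that the inner product factorizes into
cosines of differences of angles. -/
theorem sum_bernoulliVector_mul (a b : Y → ℝ) (U : Finset Y) :
    ∑ A ∈ U.powerset, bernoulliVector a U A * bernoulliVector b U A =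
      ∏ y ∈ U, Real.cos (Real.pi / 2 * (a y - b y)) := by
  have : ∀ y, Real.cos (Real.pi / 2 * (a y - b y)) =
      Real.sin (Real.pi / 2 * a y) * Real.sin (Real.pi / 2 * b y) +
        Real.cos (Real.pi / 2 * a y) * Real.cos (Real.pi / 2 * b y) := fun y => by
    rw [mul_sub, Real.cos_sub]
    ring
  simp only [this]
  rw [Finset.prod_add]
  refine Finset.sum_congr rfl fun A _ => ?_
  rw [bernoulliVector, bernoulliVector, Finset.prod_mul_distrib, Finset.prod_mul_distrib]
  ring

theorem sum_bernoulliVector_sq (a : Y → ℝ) (U : Finset Y) :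
    ∑ A ∈ U.powerset, bernoulliVector a U A ^ 2 = 1 := by
  simp only [pow_two, sum_bernoulliVector_mul, sub_self, mul_zero, Real.cos_zero,
    Finset.prod_const_one]

theorem isMean_bernoulliMean (a : Y → ℝ) (U : Finset Y) : IsMean (bernoulliMean a U) where
  add _ _ := by simp only [bernoulliMean, mul_add, Finset.sum_add_distrib]
  mono _ _ h := Finset.sum_le_sum fun A _ => mul_le_mul_of_nonneg_left (h A) (sq_nonneg _)
  const c := by rw [bernoulliMean, ← Finset.sum_mul, sum_bernoulliVector_sq, one_mul]

theorem bernoulliMean_of_subset (a : Y → ℝ) {U V : Finset Y} (hUV : U ⊆ V)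
    (ha : ∀ y, y ∉ U → a y = 0) (f : Finset Y → ℝ) : bernoulliMean a U f = bernoulliMean a V f := by
  have h : ∀ A ∈ U.powerset, bernoulliVector a U A = bernoulliVector a V A := by
    intro A hA
    rw [bernoulliVector, bernoulliVector]
    congr 1
    refine Finset.prod_subset (Finset.sdiff_subset_sdiff hUV le_rfl) fun y hy hy' => ?_
    have : y ∉ U := fun h => hy' (Finset.mem_sdiff.2 ⟨h, (Finset.mem_sdiff.1 hy).2⟩)
    rw [ha y this, mul_zero, Real.cos_zero]
  rw [bernoulliMean, Finset.sum_congr rfl fun A hA => by rw [h A hA]]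
  refine Finset.sum_subset (Finset.powerset_mono.2 hUV) fun A _ hA => ?_
  obtain ⟨y, hyA, hyU⟩ := Finset.not_subset.1 fun h => hA (Finset.mem_powerset.2 h)
  rw [bernoulliVector, Finset.prod_eq_zero hyA (by rw [ha y hyU, mul_zero, Real.sin_zero])]
  simp

theorem one_sub_sum_le_prod_cos (δ : Y → ℝ) (U : Finset Y) (hδ : ∀ y, |δ y| ≤ Real.pi / 2) :
    1 - ∑ y ∈ U, δ y ^ 2 / 2 ≤ ∏ y ∈ U, Real.cos (δ y) := by
  have h0 : ∀ y, 0 ≤ Real.cos (δ y) := fun y => Real.cos_nonneg_of_mem_Icc (abs_le.1 (hδ y))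
  induction U using Finset.induction_on with
  | empty => simp
  | insert y U hy ih =>
    rw [Finset.sum_insert hy, Finset.prod_insert hy]
    have h1 := Real.one_sub_sq_div_two_le_cos (x := δ y)
    have h2 : ∏ y ∈ U, Real.cos (δ y) ≤ 1 :=
      Finset.prod_le_one (fun y _ => h0 y) fun y _ => Real.cos_le_one _
    have h3 := Real.cos_le_one (δ y)
    nlinarith [h0 y, mul_nonneg (sub_nonneg.2 h2) (sub_nonneg.2 h3)]

/-- The inner product of the two unit vectors is at least `1 - 2 * ε`, so their squared distance is
at most `4 * ε`. Factoring the difference of squares and applying Cauchy–Schwarz bounds the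
difference of the laws, the sum of the vectors having squared norm at most `4`. -/
theorem abs_bernoulliMean_sub_le {a b : Y → ℝ} (ha : ∀ y, a y ∈ Set.Icc (0 : ℝ) 1)
    (hb : ∀ y, b y ∈ Set.Icc (0 : ℝ) 1) {U : Finset Y} {ε : ℝ}
    (hab : ∑ y ∈ U, (b y - a y) ^ 2 ≤ ε) {f : Finset Y → ℝ} {C : ℝ} (hC : ∀ A, |f A| ≤ C) :
    |bernoulliMean b U f - bernoulliMean a U f| ≤ C * Real.sqrt (16 * ε) := by
  set ξ := bernoulliVector a U
  set η := bernoulliVector b U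
  have hC0 : 0 ≤ C := (abs_nonneg _).trans (hC ∅)
  have hcos : 1 - 2 * ε ≤ ∑ A ∈ U.powerset, η A * ξ A := by
    rw [sum_bernoulliVector_mul]
    refine le_trans ?_ (one_sub_sum_le_prod_cos _ U fun y => ?_)
    · have h4 : (Real.pi / 2) ^ 2 ≤ 4 := by nlinarith [Real.pi_pos, Real.pi_lt_four]
      have : ∑ y ∈ U, (Real.pi / 2 * (b y - a y)) ^ 2 / 2 =
          (Real.pi / 2) ^ 2 / 2 * ∑ y ∈ U, (b y - a y) ^ 2 := by
        rw [Finset.mul_sum]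
        exact Finset.sum_congr rfl fun y _ => by ring
      rw [this]
      have h0 : 0 ≤ ∑ y ∈ U, (b y - a y) ^ 2 := Finset.sum_nonneg fun _ _ => sq_nonneg _
      nlinarith
    · rw [abs_mul, abs_of_pos (by positivity)]
      have : |b y - a y| ≤ 1 := by
        rw [abs_le]
        constructor <;> linarith [(ha y).1, (ha y).2, (hb y).1, (hb y).2]
      exact mul_le_of_le_one_right (by positivity) this
  have e1 : ∑ A ∈ U.powerset, ξ A ^ 2 = 1 := sum_bernoulliVector_sq a U
  have e2 : ∑ A ∈ U.powerset, η A ^ 2 = 1 := sum_bernoulliVector_sq b U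
  have hm : ∑ A ∈ U.powerset, (η A - ξ A) ^ 2 ≤ 4 * ε := by
    have : ∑ A ∈ U.powerset, (η A - ξ A) ^ 2 = ∑ A ∈ U.powerset, η A ^ 2 +
        ∑ A ∈ U.powerset, ξ A ^ 2 - 2 * ∑ A ∈ U.powerset, η A * ξ A := by
      rw [Finset.mul_sum, ← Finset.sum_add_distrib, ← Finset.sum_sub_distrib]
      exact Finset.sum_congr rfl fun A _ => by ring
    linarith
  have hp : ∑ A ∈ U.powerset, (η A + ξ A) ^ 2 ≤ 4 := by
    have : ∑ A ∈ U.powerset, (η A + ξ A) ^ 2 ≤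
        ∑ A ∈ U.powerset, (2 * η A ^ 2 + 2 * ξ A ^ 2) :=
      Finset.sum_le_sum fun A _ => by nlinarith [sq_nonneg (η A - ξ A)]
    rw [Finset.sum_add_distrib, ← Finset.mul_sum, ← Finset.mul_sum, e1, e2] at this
    linarith
  have hcs : (∑ A ∈ U.powerset, |η A - ξ A| * |η A + ξ A|) ^ 2 ≤ 16 * ε := by
    refine (Finset.sum_mul_sq_le_sq_mul_sq _ _ _).trans ?_
    simp only [sq_abs]
    have h0 : 0 ≤ ∑ A ∈ U.powerset, (η A - ξ A) ^ 2 := Finset.sum_nonneg fun _ _ => sq_nonneg _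
    nlinarith
  have hle : ∑ A ∈ U.powerset, |η A - ξ A| * |η A + ξ A| ≤ Real.sqrt (16 * ε) :=
    Real.le_sqrt_of_sq_le hcs
  calc |bernoulliMean b U f - bernoulliMean a U f|
      = |∑ A ∈ U.powerset, (η A - ξ A) * (η A + ξ A) * f A| := by
        rw [bernoulliMean, bernoulliMean, ← Finset.sum_sub_distrib]
        congr 1
        exact Finset.sum_congr rfl fun A _ => by ring
    _ ≤ ∑ A ∈ U.powerset, |η A - ξ A| * |η A + ξ A| * C := by
        refine (Finset.abs_sum_le_sum_abs _ _).trans (Finset.sum_le_sum fun A _ => ?_)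
        rw [abs_mul, abs_mul]
        exact mul_le_mul_of_nonneg_left (hC A) (by positivity)
    _ ≤ C * Real.sqrt (16 * ε) := by
        rw [← Finset.sum_mul, mul_comm]
        exact mul_le_mul_of_nonneg_left hle hC0

theorem bernoulliMean_comp_symm (a : Y → ℝ) (U : Finset Y) (e : Equiv.Perm Y)
    (f : Finset Y → ℝ) :
    bernoulliMean a U (fun A => f (e.symm.finsetCongr A)) =
      bernoulliMean (fun y => a (e y)) (e.symm.finsetCongr U) f := by
  refine Finset.sum_equiv e.symm.finsetCongr (fun A => ?_) fun A _ => ?_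
  · simp only [Equiv.finsetCongr_apply, Finset.mem_powerset, Finset.map_subset_map]
  · congr 2
    simp only [bernoulliVector, Equiv.finsetCongr_apply, ← Finset.map_sdiff, Finset.prod_map,
      Equiv.coe_toEmbedding, Equiv.apply_symm_apply]

theorem abs_bernoulliMean_comp_sub_le {a : Y → ℝ} (ha : ∀ y, a y ∈ Set.Icc (0 : ℝ) 1)
    {U : Finset Y} (hU : ∀ y, y ∉ U → a y = 0) (e : Equiv.Perm Y) {ε : ℝ}
    (hε : ∀ V : Finset Y, ∑ y ∈ V, (a (e y) - a y) ^ 2 ≤ ε) {f : Finset Y → ℝ} {C : ℝ}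
    (hC : ∀ A, |f A| ≤ C) :
    |bernoulliMean a U (fun A => f (e.symm.finsetCongr A)) - bernoulliMean a U f| ≤
      C * Real.sqrt (16 * ε) := by
  rw [bernoulliMean_comp_symm,
    bernoulliMean_of_subset _ (Finset.subset_union_right (s₁ := U)) (fun y hy => hU _ fun h => hy ?_),
    bernoulliMean_of_subset a (Finset.subset_union_left (s₂ := e.symm.finsetCongr U)) hU]
  · exact abs_bernoulliMean_sub_le ha (fun y => ha _) (hε _) hC
  · rw [Equiv.finsetCongr_apply, Finset.mem_map_equiv]
    simpa using h

/-- Where `a` equals one the angle is a right angle, so a set that omits such a point has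
probability zero. -/
theorem bernoulliMean_congr {a : Y → ℝ} {U : Finset Y} (hU : ∀ y, y ∉ U → a y = 0) {E : Set Y}
    (hE : ∀ y ∈ E, a y = 1) {f f' : Finset Y → ℝ} (h : ∀ A : Finset Y, E ⊆ A → f A = f' A) :
    bernoulliMean a U f = bernoulliMean a U f' := by
  refine Finset.sum_congr rfl fun A _ => ?_
  by_cases hEA : E ⊆ A
  · rw [h A hEA]
  · obtain ⟨y, hyE, hyA⟩ := Set.not_subset.1 hEA
    have hyU : y ∈ U := by
      by_contra hyU
      exact zero_ne_one ((hU y hyU).symm.trans (hE y hyE))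
    have : bernoulliVector a U A = 0 := by
      rw [bernoulliVector, Finset.prod_eq_zero (i := y) (s := U \ A)
        (Finset.mem_sdiff.2 ⟨hyU, hyA⟩) (by rw [hE y hyE, mul_one, Real.cos_pi_div_two]), mul_zero]
    rw [this]
    simp

end BernoulliVector

open Filter in
/-- Finitely supported functions of arbitrarily small energy, equal to one on given sets, yield an
invariant mean on finite subsets concentrated on those that contain the given sets. -/
theorem exists_mean_finset {G Y : Type*} [Group G] (ρ : G →* Equiv.Perm Y) (E : G → Set Y)
    (h : ∀ (S : Finset G) (ε : ℝ), 0 < ε → ∃ a : Y → ℝ, (∀ y, a y ∈ Set.Icc (0 : ℝ) 1) ∧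
      (∃ U : Finset Y, ∀ y, y ∉ U → a y = 0) ∧ (∀ s ∈ S, ∀ y ∈ E s, a y = 1) ∧
      ∀ s ∈ S, ∀ V : Finset Y, ∑ y ∈ V, (a (ρ s y) - a y) ^ 2 ≤ ε) :
    ∃ m : (Finset Y → ℝ) → ℝ, IsMean m ∧
      (∀ (g : G) (f : Finset Y → ℝ), IsBddFun f →
        m (fun A => f ((ρ g).finsetCongr A)) = m f) ∧
      ∀ (g : G) (f f' : Finset Y → ℝ), IsBddFun f → IsBddFun f' →
        (∀ A : Finset Y, E g ⊆ A → f A = f' A) → m f = m f' := by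
  classical
  have h' : ∀ i : Finset G × ℕ, ∃ (a : Y → ℝ) (U : Finset Y), (∀ y, a y ∈ Set.Icc (0 : ℝ) 1) ∧
      (∀ y, y ∉ U → a y = 0) ∧ (∀ s ∈ i.1, ∀ y ∈ E s, a y = 1) ∧
      ∀ s ∈ i.1, ∀ V : Finset Y, ∑ y ∈ V, (a (ρ s y) - a y) ^ 2 ≤ 1 / ((i.2 : ℝ) + 1) := by
    intro i
    obtain ⟨a, ha, ⟨U, hU⟩, h1, h2⟩ := h i.1 (1 / ((i.2 : ℝ) + 1)) Nat.one_div_pos_of_nat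
    exact ⟨a, U, ha, hU, h1, h2⟩
  choose a U ha hU h1 h2 using h'
  obtain ⟨m, hm, hlim⟩ := exists_limit_mean atTop (fun i => bernoulliMean (a i) (U i))
    fun i => isMean_bernoulliMean _ _
  have hev : ∀ g : G, ∀ᶠ i : Finset G × ℕ in atTop, g ∈ i.1 := fun g => by
    filter_upwards [eventually_ge_atTop (({g}, 0) : Finset G × ℕ)] with i hi
    exact hi.1 (Finset.mem_singleton_self g)
  have hinv : ∀ (g : G) (f : Finset Y → ℝ), IsBddFun f →
      m (fun A => f ((ρ g).symm.finsetCongr A)) = m f := by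
    intro g f hf
    obtain ⟨C, hC⟩ := hf
    refine hlim _ _ (IsBddFun.comp ⟨C, hC⟩ _) ⟨C, hC⟩ ?_
    have ht : Tendsto (fun i : Finset G × ℕ => C * Real.sqrt (16 * (1 / ((i.2 : ℝ) + 1)))) atTop
        (nhds 0) := by
      have h0 := tendsto_one_div_add_atTop_nhds_zero_nat (𝕜 := ℝ)
      have h3 := ((h0.const_mul 16).sqrt).const_mul C
      simp only [mul_zero, Real.sqrt_zero] at h3
      refine h3.comp ?_
      rw [← prod_atTop_atTop_eq]
      exact tendsto_snd
    refine squeeze_zero_norm' ?_ ht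
    filter_upwards [hev g] with i hi
    exact abs_bernoulliMean_comp_sub_le (ha i) (hU i) (ρ g) (h2 i g hi) hC
  refine ⟨m, hm, fun g f hf => ?_, fun g f f' hf hf' hff => hlim f f' hf hf' ?_⟩
  · have := hinv g⁻¹ f hf
    rwa [map_inv] at this
  · refine tendsto_const_nhds.congr' ?_
    filter_upwards [hev g] with i hi
    exact (sub_eq_zero.2 (bernoulliMean_congr (hU i) (h1 i g hi) hff)).symm

/-! ### Functions of small energy -/

section HarmonicAverage

open Classical in
/-- The harmonically weighted average of the indicators of the first `N` sets of a sequence. -/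
noncomputable def harmonicAverage {Y : Type*} (F : ℕ → Set Y) (N : ℕ) (y : Y) : ℝ :=
  (∑ n ∈ Finset.range N, if y ∈ F n then 1 / ((n : ℝ) + 1) else 0) /
    ∑ n ∈ Finset.range N, 1 / ((n : ℝ) + 1)

variable {Y : Type*} {F : ℕ → Set Y}

theorem harmonicAverage_mem_Icc (F : ℕ → Set Y) (N : ℕ) (y : Y) :
    harmonicAverage F N y ∈ Set.Icc (0 : ℝ) 1 := by
  have h0 : ∀ n : ℕ, (0 : ℝ) ≤ 1 / ((n : ℝ) + 1) := fun n => Nat.one_div_pos_of_nat.le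
  refine ⟨div_nonneg (Finset.sum_nonneg fun n _ => ?_) (Finset.sum_nonneg fun n _ => h0 n),
    div_le_one_of_le₀ (Finset.sum_le_sum fun n _ => ?_) (Finset.sum_nonneg fun n _ => h0 n)⟩
  · split_ifs
    exacts [h0 n, le_rfl]
  · split_ifs
    exacts [le_rfl, h0 n]

theorem harmonicAverage_eq_zero (hF : Monotone F) {N : ℕ} {y : Y} (hy : y ∉ F N) :
    harmonicAverage F N y = 0 := by
  rw [harmonicAverage, Finset.sum_eq_zero, zero_div]
  intro n hn
  rw [if_neg fun h => hy (hF (Finset.mem_range.1 hn).le h)]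

theorem harmonicAverage_eq_one (hF : Monotone F) {N : ℕ} (hN : 0 < N) {y : Y} (hy : y ∈ F 0) :
    harmonicAverage F N y = 1 := by
  have : 0 < ∑ n ∈ Finset.range N, 1 / ((n : ℝ) + 1) :=
    Finset.sum_pos (fun n _ => Nat.one_div_pos_of_nat) (Finset.nonempty_range_iff.2 hN.ne')
  rw [harmonicAverage, div_eq_one_iff_eq this.ne']
  exact Finset.sum_congr rfl fun n _ => if_pos (hF (Nat.zero_le n) hy)

/-- If boundaries grow linearly and every edge lies in boundedly many boundaries, then the energy
of the harmonic average is inversely proportional to the harmonic sum. -/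
theorem sum_harmonicAverage_sub_sq_le (hF : Monotone F) (σ : Y → Y) {K : ℕ} {C : ℝ}
    (h1 : ∀ x n, x ∈ F n → σ x ∈ F (n + K)) (h2 : ∀ x n, σ x ∈ F n → x ∈ F (n + K))
    (hC : ∀ (n : ℕ) (V : Finset Y), (∀ x ∈ V, ¬ (σ x ∈ F n ↔ x ∈ F n)) → (V.card : ℝ) ≤ C * (n + 1))
    {N : ℕ} (hN : 0 < N) (V : Finset Y) :
    ∑ x ∈ V, (harmonicAverage F N (σ x) - harmonicAverage F N x) ^ 2 ≤
      K * C / ∑ n ∈ Finset.range N, 1 / ((n : ℝ) + 1) := by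
  classical
  set H := ∑ n ∈ Finset.range N, 1 / ((n : ℝ) + 1) with hH
  have hHpos : 0 < H :=
    Finset.sum_pos (fun n _ => Nat.one_div_pos_of_nat) (Finset.nonempty_range_iff.2 hN.ne')
  let c : ℕ → ℝ := fun n => 1 / ((n : ℝ) + 1)
  let β : ℕ → Y → ℝ := fun n x => if ¬ (σ x ∈ F n ↔ x ∈ F n) then 1 else 0
  have hβ0 : ∀ n x, 0 ≤ β n x := fun n x => by
    dsimp only [β]
    split_ifs <;> norm_num
  have hc0 : ∀ n, 0 ≤ c n := fun n => Nat.one_div_pos_of_nat.le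
  have hββ : ∀ n x, β n x ^ 2 = β n x := fun n x => by
    dsimp only [β]
    split_ifs <;> norm_num
  -- If `n0` is the first index at which an endpoint of the edge enters, then both endpoints are
  -- inside from `n0 + K` on.
  have hβK : ∀ x, ∑ n ∈ Finset.range N, β n x ≤ K := by
    intro x
    dsimp only [β]
    rw [Finset.sum_boole]
    by_cases hx : ∃ n, x ∈ F n ∨ σ x ∈ F n
    · have hn0 := Nat.find_spec hx
      set n0 := Nat.find hx with hn0def
      have hsub : (Finset.range N).filter (fun n => ¬ (σ x ∈ F n ↔ x ∈ F n)) ⊆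
          Finset.Ico n0 (n0 + K) := by
        intro n hn
        have hn' := (Finset.mem_filter.1 hn).2
        rw [Finset.mem_Ico]
        constructor
        · by_contra! hlt
          have := Nat.find_min hx hlt
          tauto
        · by_contra! hge
          have hx1 : x ∈ F (n0 + K) := by
            rcases hn0 with h | h
            · exact hF (Nat.le_add_right _ _) h
            · exact h2 x n0 h
          have hx2 : σ x ∈ F (n0 + K) := by
            rcases hn0 with h | h
            · exact h1 x n0 h
            · exact hF (Nat.le_add_right _ _) h
          exact hn' ⟨fun _ => hF hge hx1, fun _ => hF hge hx2⟩
      have := Finset.card_le_card hsub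
      rw [Nat.card_Ico, Nat.add_sub_cancel_left] at this
      exact_mod_cast this
    · push Not at hx
      rw [Finset.filter_false_of_mem fun n _ => by simp [hx n]]
      simp
  have hpt : ∀ x, (harmonicAverage F N (σ x) - harmonicAverage F N x) ^ 2 ≤
      (K * ∑ n ∈ Finset.range N, c n ^ 2 * β n x) / H ^ 2 := by
    intro x
    have e : harmonicAverage F N (σ x) - harmonicAverage F N x =
        (∑ n ∈ Finset.range N, ((if σ x ∈ F n then c n else 0) - if x ∈ F n then c n else 0)) / H := by
      rw [Finset.sum_sub_distrib, sub_div]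
      rfl
    rw [e, div_pow]
    refine div_le_div_of_nonneg_right ?_ (sq_nonneg _)
    have habs : |∑ n ∈ Finset.range N, ((if σ x ∈ F n then c n else 0) - if x ∈ F n then c n else 0)|
        ≤ ∑ n ∈ Finset.range N, β n x * (c n * β n x) := by
      refine (Finset.abs_sum_le_sum_abs _ _).trans (Finset.sum_le_sum fun n _ => ?_)
      by_cases hs : σ x ∈ F n <;> by_cases hx : x ∈ F n <;>
        simp [β, hs, hx, abs_of_nonneg (hc0 n)]
    rw [← sq_abs]
    -- Cauchy–Schwarz with one factor `β` split off: at most `K` terms are nonzero.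
    calc |∑ n ∈ Finset.range N, ((if σ x ∈ F n then c n else 0) - if x ∈ F n then c n else 0)| ^ 2
        ≤ (∑ n ∈ Finset.range N, β n x * (c n * β n x)) ^ 2 := pow_le_pow_left₀ (abs_nonneg _) habs 2
      _ ≤ (∑ n ∈ Finset.range N, β n x ^ 2) * ∑ n ∈ Finset.range N, (c n * β n x) ^ 2 :=
        Finset.sum_mul_sq_le_sq_mul_sq _ _ _
      _ ≤ K * ∑ n ∈ Finset.range N, c n ^ 2 * β n x := by
        simp only [mul_pow, hββ]
        exact mul_le_mul_of_nonneg_right (hβK x)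
          (Finset.sum_nonneg fun n _ => mul_nonneg (sq_nonneg _) (hβ0 n x))
  -- One of the two factors `1 / (n + 1)` cancels the linear growth of the boundary; the other sums
  -- to `H`.
  have hsum : ∑ n ∈ Finset.range N, c n ^ 2 * ∑ x ∈ V, β n x ≤ C * H := by
    rw [hH, Finset.mul_sum]
    refine Finset.sum_le_sum fun n _ => ?_
    have : ∑ x ∈ V, β n x ≤ C * (n + 1) := by
      dsimp only [β]
      rw [Finset.sum_boole]
      exact hC n _ fun x hx => (Finset.mem_filter.1 hx).2
    refine (mul_le_mul_of_nonneg_left this (sq_nonneg _)).trans (le_of_eq ?_)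
    have hn : (n : ℝ) + 1 ≠ 0 := n.cast_add_one_ne_zero
    dsimp only [c]
    field_simp
  calc ∑ x ∈ V, (harmonicAverage F N (σ x) - harmonicAverage F N x) ^ 2
      ≤ ∑ x ∈ V, (K * ∑ n ∈ Finset.range N, c n ^ 2 * β n x) / H ^ 2 :=
        Finset.sum_le_sum fun x _ => hpt x
    _ = (K * ∑ n ∈ Finset.range N, c n ^ 2 * ∑ x ∈ V, β n x) / H ^ 2 := by
        rw [← Finset.sum_div, ← Finset.mul_sum, Finset.sum_comm]
        simp only [Finset.mul_sum]
    _ ≤ (K * (C * H)) / H ^ 2 :=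
        div_le_div_of_nonneg_right (mul_le_mul_of_nonneg_left hsum K.cast_nonneg) (sq_nonneg _)
    _ = K * C / H := by
        field_simp

end HarmonicAverage

/-! ### Small energy from linear activity. -/

namespace treeAut

open InfWord

variable {X : Type*}

/-- A finite set of finite-state automorphisms is contained in a finite set that is closed under
sections and inverses. -/
theorem exists_finite_closure {G : Subgroup (treeAut X)} (hG : IsSectionClosed G)
    (hfs : ∀ g ∈ G, IsFiniteState g) {S : Set (treeAut X)} (hS : S.Finite) (hSG : S ⊆ G) :
    ∃ S' : Set (treeAut X), S'.Finite ∧ S ⊆ S' ∧ S' ⊆ G ∧ 1 ∈ S' ∧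
      (∀ s ∈ S', ∀ v, sectionAt s v ∈ S') ∧ ∀ s ∈ S', s⁻¹ ∈ S' := by
  let B := insert 1 S
  have hB : B.Finite := hS.insert 1
  have hBG : B ⊆ G := Set.insert_subset G.one_mem hSG
  refine ⟨⋃ s ∈ B, (Set.range (sectionAt s) ∪ Set.range (sectionAt s⁻¹)), ?_, ?_, ?_, ?_, ?_, ?_⟩
  · exact hB.biUnion fun s hs => (hfs s (hBG hs)).union (hfs s⁻¹ (G.inv_mem (hBG hs)))
  · exact fun s hs => Set.mem_biUnion (Set.mem_insert_of_mem 1 hs) (Or.inl ⟨[], sectionAt_nil s⟩)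
  · refine Set.iUnion₂_subset fun s hs => Set.union_subset ?_ ?_
    · rintro _ ⟨v, rfl⟩
      exact hG s (hBG hs) v
    · rintro _ ⟨v, rfl⟩
      exact hG s⁻¹ (G.inv_mem (hBG hs)) v
  · exact Set.mem_biUnion (Set.mem_insert 1 S) (Or.inl ⟨[], sectionAt_nil 1⟩)
  · intro s hs v
    obtain ⟨t, ht, h⟩ := Set.mem_iUnion₂.1 hs
    refine Set.mem_biUnion ht ?_
    rcases h with ⟨w, rfl⟩ | ⟨w, rfl⟩
    · exact Or.inl ⟨w ++ v, sectionAt_append _ _ _⟩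
    · exact Or.inr ⟨w ++ v, sectionAt_append _ _ _⟩
  · intro s hs
    obtain ⟨t, ht, h⟩ := Set.mem_iUnion₂.1 hs
    refine Set.mem_biUnion ht ?_
    rcases h with ⟨w, rfl⟩ | ⟨w, rfl⟩
    · exact Or.inr ⟨t.1 w, (inv_sectionAt _ _).symm⟩
    · exact Or.inl ⟨(t⁻¹).1 w, by rw [inv_sectionAt, inv_inv]⟩

theorem finite_drop_mem [Finite X] {T : Set (ℕ → X)} (hT : T.Finite) (n : ℕ) :
    {y | drop n y ∈ T}.Finite := by
  refine Set.Finite.of_finite_image (f := fun y => (pre y n, drop n y))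
    (((List.finite_length_eq X n).prod hT).subset ?_) ?_
  · rintro _ ⟨y, hy, rfl⟩
    exact ⟨length_pre y n, hy⟩
  · intro y _ z _ h
    exact eq_of_pre_of_drop n (congrArg Prod.fst h) (congrArg Prod.snd h)

/-- The number of edges that leave the set of infinite words with given tails. -/
theorem card_exit_le [Finite X] {T : Set (ℕ → X)} (hT : T.Finite) (g : treeAut X) (n : ℕ)
    (V : Finset (ℕ → X)) (hV : ∀ x ∈ V, drop n x ∈ T ∧ drop n (act g x) ∉ T) :
    V.card ≤ activity g n * T.ncard := by
  rw [activity, ← Set.ncard_prod, ← Set.ncard_coe_finset]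
  refine Set.ncard_le_ncard_of_injOn (fun y => (pre y n, drop n y)) (fun x hx => ?_)
    (fun y _ z _ h => eq_of_pre_of_drop n (congrArg Prod.fst h) (congrArg Prod.snd h))
    ((finite_active g n).prod hT)
  obtain ⟨h1, h2⟩ := hV x hx
  refine ⟨⟨length_pre x n, fun h => h2 ?_⟩, h1⟩
  rw [drop_act, h, act_one]
  exact h1

theorem card_boundary_le [Finite X] {T : Set (ℕ → X)} (hT : T.Finite) (g : treeAut X) (n : ℕ)
    (V : Finset (ℕ → X)) (hV : ∀ x ∈ V, ¬ (drop n (act g x) ∈ T ↔ drop n x ∈ T)) :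
    V.card ≤ (activity g n + activity g⁻¹ n) * T.ncard := by
  classical
  rw [← Finset.card_filter_add_card_filter_not (s := V) (fun x => drop n x ∈ T), add_mul]
  refine add_le_add (card_exit_le hT g n _ fun x hx => ?_) ?_
  · have := hV x (Finset.mem_filter.1 hx).1
    have := (Finset.mem_filter.1 hx).2
    tauto
  · rw [← Finset.card_map (actHom X g).toEmbedding]
    refine card_exit_le hT g⁻¹ n _ fun x hx => ?_
    obtain ⟨y, hy, rfl⟩ := Finset.mem_map.1 hx
    have h1 := hV y (Finset.mem_filter.1 hy).1
    have h2 := (Finset.mem_filter.1 hy).2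
    simp only [Equiv.coe_toEmbedding, actHom_apply, act_inv_act]
    tauto

/-- The points where `g` is singular over `D`, together with, when `g ∈ D`, the points where it
is singular over `F`. -/
def doubleSingularSet (D F : Subgroup (treeAut X)) (g : treeAut X) : Set (ℕ → X) :=
  {y | y ∈ singularSet D g ∨ g ∈ D ∧ y ∈ singularSet F g}

/-- Both layers of singular points are included in the sets where `a` is one, so that a single mean
serves both steps of the chain. -/
theorem exists_small_energy [Finite X] {G D F : Subgroup (treeAut X)}
    (HG : IsFinitelySingularOver G D) (HD : IsFinitelySingularOver D F)
    (hF : ∀ g ∈ F, ∃ n, ∀ v : List X, v.length = n → sectionAt g v = 1)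
    (hlin : ∀ g ∈ G, ∃ C : ℝ, ∀ n : ℕ, (activity g n : ℝ) ≤ C * (n + 1))
    {S : Set (treeAut X)} (hS : S.Finite) (hSG : S ⊆ G) {ε : ℝ} (hε : 0 < ε) :
    ∃ a : (ℕ → X) → ℝ, (∀ y, a y ∈ Set.Icc (0 : ℝ) 1) ∧
      (∃ U : Finset (ℕ → X), ∀ y, y ∉ U → a y = 0) ∧
      (∀ s ∈ S, ∀ y ∈ doubleSingularSet D F s, a y = 1) ∧
      ∀ s ∈ S, ∀ V : Finset (ℕ → X), ∑ y ∈ V, (a (act s y) - a y) ^ 2 ≤ ε := by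
  obtain ⟨S', hS'fin, hSS', hS'G, hS'1, hS'sec, hS'inv⟩ :=
    exists_finite_closure HG.isSectionClosed_left HG.isFiniteState hS hSG
  let Z : Set (ℕ → X) := ⋃ s ∈ S', doubleSingularSet D F s
  have hZfin : Z.Finite := by
    refine hS'fin.biUnion fun s hs => ?_
    by_cases hsD : s ∈ D
    · refine ((HG.finite_singularSet s (hS'G hs)).union (HD.finite_singularSet s hsD)).subset ?_
      rintro y (hy | hy)
      exacts [Or.inl hy, Or.inr hy.2]
    · refine (HG.finite_singularSet s (hS'G hs)).subset ?_
      rintro y (hy | hy)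
      exacts [hy, absurd hy.1 hsD]
  have hZdrop : ∀ z ∈ Z, drop 1 z ∈ Z := by
    intro z hz
    obtain ⟨s, hs, hz⟩ := Set.mem_iUnion₂.1 hz
    refine Set.mem_biUnion (hS'sec s hs (pre z 1)) ?_
    rcases hz with hz | ⟨hsD, hz⟩
    · exact Or.inl (drop_mem_singularSet_sectionAt hz 1)
    · exact Or.inr ⟨HD.isSectionClosed_left s hsD _, drop_mem_singularSet_sectionAt hz 1⟩
  -- `T` contains the images of the singular points as well as the points themselves, and is stable
  -- under removing letters.
  let T : Set (ℕ → X) := ⋃ s ∈ S', act s '' Z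
  have hTfin : T.Finite := hS'fin.biUnion fun s _ => hZfin.image _
  have hZT : Z ⊆ T := fun z hz => Set.mem_biUnion hS'1 ⟨z, hz, act_one z⟩
  have hTdrop : ∀ t ∈ T, ∀ n, drop n t ∈ T := by
    intro t ht n
    induction n with
    | zero => rwa [drop_zero]
    | succ n ih =>
      rw [← drop_drop]
      obtain ⟨s, hs, z, hz, h⟩ := Set.mem_iUnion₂.1 ih
      refine Set.mem_biUnion (hS'sec s hs (pre z 1)) ⟨drop 1 z, hZdrop z hz, ?_⟩
      rw [← h, drop_act]
  -- If `t` is singular for `u` over `D`, its image is in `T`. Otherwise some section is in `D`; if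
  -- the tail there is singular over `F`, its image is again in `T`. Otherwise a later section is
  -- trivial, and the tail of the image is a tail of `t`. Finiteness of `S'` and `T` then makes the
  -- number of removed letters uniform.
  have hreturn : ∀ p ∈ S' ×ˢ T, ∃ k, drop k (act p.1 p.2) ∈ T := by
    rintro ⟨u, t⟩ ⟨hu, ht⟩
    by_cases h1 : t ∈ singularSet D u
    · refine ⟨0, ?_⟩
      rw [drop_zero]
      exact Set.mem_biUnion hu ⟨t, Set.mem_biUnion hu (Or.inl h1), rfl⟩
    · simp only [singularSet, Set.mem_ofPred_eq, not_forall, not_not] at h1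
      obtain ⟨j, hj⟩ := h1
      by_cases h2 : drop j t ∈ singularSet F (sectionAt u (pre t j))
      · refine ⟨j, ?_⟩
        have hs := hS'sec u hu (pre t j)
        rw [drop_act]
        exact Set.mem_biUnion hs ⟨drop j t, Set.mem_biUnion hs (Or.inr ⟨hj, h2⟩), rfl⟩
      · simp only [singularSet, Set.mem_ofPred_eq, not_forall, not_not] at h2
        obtain ⟨i, hi⟩ := h2
        obtain ⟨n, hn⟩ := hF _ hi
        refine ⟨j + i + n, ?_⟩
        rw [drop_act, sectionAt_pre_add, sectionAt_pre_add, hn _ (length_pre _ _), act_one]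
        exact hTdrop t ht _
  obtain ⟨K, hK⟩ : ∃ K, ∀ u ∈ S', ∀ t ∈ T, drop K (act u t) ∈ T := by
    choose! k hk using hreturn
    obtain ⟨K, hK⟩ := ((hS'fin.prod hTfin).image k).bddAbove
    refine ⟨K, fun u hu t ht => ?_⟩
    have hle : k (u, t) ≤ K := hK ⟨_, ⟨hu, ht⟩, rfl⟩
    obtain ⟨i, rfl⟩ := Nat.exists_eq_add_of_le hle
    rw [← drop_drop]
    exact hTdrop _ (hk (u, t) ⟨hu, ht⟩) i
  let L : ℕ → Set (ℕ → X) := fun n => {y | drop n y ∈ T}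
  have hL : Monotone L := monotone_nat_of_le_succ fun n y (hy : drop n y ∈ T) => by
    change drop (n + 1) y ∈ T
    rw [← drop_drop]
    exact hTdrop _ hy 1
  have hLK : ∀ s ∈ S', ∀ x n, x ∈ L n → act s x ∈ L (n + K) := by
    intro s hs x n hx
    change drop (n + K) (act s x) ∈ T
    rw [← drop_drop, drop_act]
    exact hK _ (hS'sec s hs _) _ hx
  obtain ⟨C, hC0, hC⟩ : ∃ C : ℝ, 0 ≤ C ∧ ∀ s ∈ S', ∀ n : ℕ, (activity s n : ℝ) ≤ C * (n + 1) := by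
    have : ∀ s ∈ S', ∃ C : ℝ, ∀ n : ℕ, (activity s n : ℝ) ≤ C * (n + 1) := fun s hs =>
      hlin s (hS'G hs)
    choose! c hc using this
    obtain ⟨C, hC⟩ := (hS'fin.image c).bddAbove
    refine ⟨max C 0, le_max_right _ _, fun s hs n => (hc s hs n).trans ?_⟩
    exact mul_le_mul_of_nonneg_right ((hC ⟨s, hs, rfl⟩).trans (le_max_left _ _)) (by positivity)
  obtain ⟨N, hN, hNε⟩ : ∃ N : ℕ, 0 < N ∧
      K * (2 * C * T.ncard) / ε ≤ ∑ n ∈ Finset.range N, 1 / ((n : ℝ) + 1) := by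
    have := Real.tendsto_sum_range_one_div_nat_succ_atTop.eventually_ge_atTop
      (K * (2 * C * T.ncard) / ε)
    obtain ⟨N, hN⟩ := (this.and (Filter.eventually_gt_atTop 0)).exists
    exact ⟨N, hN.2, hN.1⟩
  have hHpos : 0 < ∑ n ∈ Finset.range N, 1 / ((n : ℝ) + 1) :=
    Finset.sum_pos (fun n _ => Nat.one_div_pos_of_nat) (Finset.nonempty_range_iff.2 hN.ne')
  refine ⟨harmonicAverage L N, harmonicAverage_mem_Icc L N,
    ⟨(finite_drop_mem hTfin N).toFinset, fun y hy => harmonicAverage_eq_zero hL fun h => hy ?_⟩,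
    fun s hs y hy => harmonicAverage_eq_one hL hN ?_, fun s hs V => ?_⟩
  · exact (finite_drop_mem hTfin N).mem_toFinset.2 h
  · change drop 0 y ∈ T
    rw [drop_zero]
    exact hZT (Set.mem_biUnion (hSS' hs) hy)
  · have hs' := hSS' hs
    refine (sum_harmonicAverage_sub_sq_le (C := 2 * C * T.ncard) hL (act s) (hLK s hs')
      (fun x n hx => ?_) (fun n V hV => ?_) hN V).trans ?_
    · have := hLK _ (hS'inv s hs') _ n hx
      rwa [act_inv_act] at this
    · have h1 : (V.card : ℝ) ≤ (activity s n + activity s⁻¹ n) * T.ncard := by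
        exact_mod_cast card_boundary_le hTfin s n V hV
      refine h1.trans ?_
      have h2 := hC s hs' n
      have h3 := hC _ (hS'inv s hs') n
      have : (activity s n + activity s⁻¹ n : ℝ) ≤ 2 * C * (n + 1) := by linarith
      refine (mul_le_mul_of_nonneg_right this (Nat.cast_nonneg _)).trans (le_of_eq ?_)
      ring
    · rwa [div_le_iff₀ hHpos, mul_comm ε, ← div_le_iff₀ hε]

end treeAut

/-! ### Finitary automorphisms and the linear activity group -/

namespace treeAut

open InfWord

universe u

variable {X : Type u}

/-- The group of finitary automorphisms: all sections at sufficiently long words are trivial. -/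
def finitary (X : Type*) : Subgroup (treeAut X) where
  carrier := {g | ∃ n, ∀ v : List X, n ≤ v.length → sectionAt g v = 1}
  one_mem' := ⟨0, fun v _ => sectionAt_one v⟩
  mul_mem' := by
    rintro g h ⟨m, hm⟩ ⟨n, hn⟩
    refine ⟨max m n, fun v hv => ?_⟩
    rw [sectionAt_mul, hn v (le_trans (le_max_right _ _) hv),
      hm _ (by rw [length_apply]; exact le_trans (le_max_left _ _) hv), one_mul]
  inv_mem' := by
    rintro g ⟨n, hn⟩
    refine ⟨n, fun v hv => ?_⟩
    rw [sectionAt_inv, hn _ (by rwa [length_apply]), inv_one]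

theorem mem_finitary_of_level {g : treeAut X} {n : ℕ}
    (h : ∀ v : List X, v.length = n → sectionAt g v = 1) : g ∈ finitary X :=
  ⟨n, fun v hv => by
    rw [← List.take_append_drop n v, sectionAt_append, h _ (by rw [List.length_take]; omega),
      sectionAt_one]⟩

theorem isSectionClosed_finitary : IsSectionClosed (finitary X) := by
  rintro g ⟨n, hn⟩ v
  refine ⟨n, fun w hw => ?_⟩
  rw [← sectionAt_append, hn _ (by rw [List.length_append]; omega)]

theorem mem_finitary_of_forall_letter [Finite X] {g : treeAut X}
    (h : ∀ x, sectionAt g [x] ∈ finitary X) : g ∈ finitary X := by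
  choose n hn using h
  obtain ⟨N, hN⟩ := (Set.finite_range n).bddAbove
  refine ⟨N + 1, fun v hv => ?_⟩
  cases v with
  | nil => simp at hv
  | cons x v =>
    rw [← List.singleton_append, sectionAt_append, hn x]
    exact (hN ⟨x, rfl⟩).trans (by simpa using hv)

/-- The automorphisms with trivial sections from level `n` on are determined by their action on the
finitely many words of length at most `n`; these groups exhaust the finitary group. -/
theorem hasInvariantMean_finitary [Finite X] : HasInvariantMean (finitary X) := by
  let K : ℕ → Subgroup (finitary X) := fun n =>
    { carrier := {g | ∀ v : List X, n ≤ v.length → sectionAt (g : treeAut X) v = 1}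
      one_mem' := fun v _ => sectionAt_one v
      mul_mem' := by
        intro g h hg hh v hv
        rw [Subgroup.coe_mul, sectionAt_mul, hh v hv, hg _ (by rwa [length_apply]), one_mul]
      inv_mem' := by
        intro g hg v hv
        rw [Subgroup.coe_inv, sectionAt_inv, hg _ (by rwa [length_apply]), inv_one] }
  refine .of_eventually_mem K (Filter.Eventually.of_forall fun n => ?_) fun g => ?_
  · have : Finite {v : List X // v.length ≤ n} := List.finite_length_le X n
    refine .of_fix_finite ((wordHom X).comp ((finitary X).subtype.comp (K n).subtype))
      (fun v => v.length ≤ n) (fun g v => by simp [length_apply]) fun K₀ hK₀ => ?_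
    have hone : ∀ k ∈ K₀, k = 1 := by
      intro k hk
      refine Subtype.ext (Subtype.ext (ext' fun w => ?_))
      have hfix : ∀ v : List X, v.length ≤ n → (k : treeAut X).1 v = v := hK₀ k hk
      change (k : treeAut X).1 w = w
      rcases le_total w.length n with hw | hw
      · exact hfix w hw
      · have ht : (w.take n).length = n := by rw [List.length_take]; omega
        conv_lhs => rw [← List.take_append_drop n w]
        rw [apply_append, hfix _ ht.le, k.2 _ ht.ge, one_apply, List.take_append_drop]
    have : Subsingleton K₀ :=
      ⟨fun a b => Subtype.ext ((hone a a.2).trans (hone b b.2).symm)⟩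
    exact .of_finite K₀
  · obtain ⟨n, hn⟩ := g.2
    filter_upwards [Filter.eventually_ge_atTop n] with m hm v hv
    exact hn v (hm.trans hv)

/-! ### Activity counts and the finiteness of singular sets. -/

theorem sum_activity_sectionAt_le [Finite X] (g : treeAut X) (k n : ℕ) (V : Finset (List X))
    (hV : ∀ v ∈ V, v.length = k) :
    ∑ v ∈ V, activity (sectionAt g v) n ≤ activity g (k + n) := by
  have h : ∀ s m, activity s m = (finite_active (X := X) s m).toFinset.card := fun s m =>
    Set.ncard_eq_toFinset_card _ _
  simp only [h]
  rw [← Finset.card_sigma]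
  refine Finset.card_le_card_of_injOn (fun p => p.1 ++ p.2) ?_ ?_
  · rintro ⟨v, w⟩ hp
    simp only [Finset.coe_sigma, Set.mem_sigma_iff, Finset.mem_coe, Set.Finite.mem_toFinset,
      Set.mem_ofPred_eq] at hp
    simp only [Finset.mem_coe, Set.Finite.mem_toFinset, Set.mem_ofPred_eq, List.length_append,
      sectionAt_append]
    exact ⟨by rw [hV v hp.1, hp.2.1], hp.2.2⟩
  · rintro ⟨v, w⟩ hp ⟨v', w'⟩ hp' heq
    simp only [Finset.coe_sigma, Set.mem_sigma_iff, Finset.mem_coe] at hp hp'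
    obtain ⟨h1, h2⟩ := List.append_inj heq (by rw [hV v hp.1, hV v' hp'.1])
    subst h1 h2
    rfl

theorem activity_sectionAt_le [Finite X] (g : treeAut X) (v : List X) (n : ℕ) :
    activity (sectionAt g v) n ≤ activity g (v.length + n) := by
  simpa using sum_activity_sectionAt_le g v.length n {v} (by simp)

theorem activity_pos_of_notMem_finitary [Finite X] {g : treeAut X} (hg : g ∉ finitary X) (n : ℕ) :
    0 < activity g n := by
  by_contra! h
  have h0 : activity g n = 0 := by omega
  rw [activity, Set.ncard_eq_zero (finite_active g n)] at h0
  refine hg (mem_finitary_of_level (n := n) fun v hv => ?_)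
  by_contra hne
  exact Set.notMem_empty v (h0 ▸ (⟨hv, hne⟩ : v ∈ {v | v.length = n ∧ sectionAt g v ≠ 1}))

theorem isSectionClosed_polyActivityGroup [Finite X] (d : ℕ) :
    IsSectionClosed (polyActivityGroup d X) := by
  rintro g ⟨hg, p, hp, hpn⟩ v
  refine ⟨hg.sectionAt v, p.comp (Polynomial.X + Polynomial.C (v.length : ℝ)), ?_, fun n => ?_⟩
  · rwa [Polynomial.natDegree_comp, Polynomial.natDegree_X_add_C, mul_one]
  · rw [Polynomial.eval_comp, Polynomial.eval_add, Polynomial.eval_X, Polynomial.eval_C]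
    have h1 : (activity (sectionAt g v) n : ℝ) ≤ activity g (v.length + n) := by
      exact_mod_cast activity_sectionAt_le g v n
    refine h1.trans ((hpn _).trans (le_of_eq ?_))
    rw [Nat.cast_add, add_comm]

theorem exists_activity_le [Finite X] {g : treeAut X} (hg : g ∈ polyActivityGroup 1 X) :
    ∃ C : ℝ, ∀ n : ℕ, (activity g n : ℝ) ≤ C * (n + 1) := by
  obtain ⟨-, p, hp, hpn⟩ := hg
  refine ⟨|p.coeff 0| + |p.coeff 1|, fun n => (hpn n).trans ?_⟩
  rw [Polynomial.eval_eq_sum_range' (n := 2) (by omega), Finset.sum_range_succ,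
    Finset.sum_range_one, pow_zero, pow_one, mul_one]
  have hn : (0 : ℝ) ≤ n := n.cast_nonneg
  have h0 := le_abs_self (p.coeff 0)
  have h1 := mul_le_mul_of_nonneg_right (le_abs_self (p.coeff 1)) hn
  nlinarith [mul_nonneg (abs_nonneg (p.coeff 0)) hn, abs_nonneg (p.coeff 1)]

/-- The elements of `P_1(X)` with finitely many non-finitary points. -/
def boundedSubgroup (X : Type*) [Finite X] : Subgroup (treeAut X) where
  carrier := {g | g ∈ polyActivityGroup 1 X ∧ (singularSet (finitary X) g).Finite}
  one_mem' := ⟨one_mem _, by rw [singularSet_one]; exact Set.finite_empty⟩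
  mul_mem' := by
    rintro g h ⟨hg, hg'⟩ ⟨hh, hh'⟩
    refine ⟨mul_mem hg hh, (hh'.union (hg'.preimage (actHom X h).injective.injOn)).subset ?_⟩
    exact fun y hy => singularSet_mul isSectionClosed_finitary hy
  inv_mem' := by
    rintro g ⟨hg, hg'⟩
    refine ⟨inv_mem hg, (hg'.image (act g)).subset fun y hy => ⟨act g⁻¹ y, ?_, act_act_inv g y⟩⟩
    rwa [← act_mem_singularSet_inv, act_act_inv]

theorem isSectionClosed_boundedSubgroup [Finite X] : IsSectionClosed (boundedSubgroup X) := by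
  rintro g ⟨hg, hg'⟩ v
  refine ⟨isSectionClosed_polyActivityGroup 1 g hg v, ?_⟩
  refine Set.Finite.of_finite_image (f := append v) (hg'.subset ?_) fun y _ z _ h => ?_
  · rintro _ ⟨y, hy, rfl⟩
    exact (append_mem_singularSet isSectionClosed_finitary).2 hy
  · rw [← drop_append v y, h, drop_append]

theorem mem_boundedSubgroup_of_forall_letter [Finite X] {g : treeAut X}
    (hg : g ∈ polyActivityGroup 1 X) (h : ∀ x, sectionAt g [x] ∈ boundedSubgroup X) :
    g ∈ boundedSubgroup X := by
  refine ⟨hg, (Set.finite_iUnion fun x => (h x).2.image (append [x])).subset fun y hy => ?_⟩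
  exact Set.mem_iUnion.2 ⟨y 0, drop 1 y, drop_mem_singularSet_sectionAt hy 1, append_pre_drop 1 y⟩

/-- The states of an element of `P_1(X)` that are not in the bounded subgroup have uniformly linear
activity. -/
theorem exists_le_activity [Finite X] {g : treeAut X} (hg : g ∈ polyActivityGroup 1 X) :
    ∃ M : ℕ, ∀ j : ℕ, ∀ s ∈ Set.range (sectionAt g), s ∉ boundedSubgroup X →
      j ≤ activity s (j * M) := by
  classical
  have hsG : ∀ s ∈ Set.range (sectionAt g), s ∈ polyActivityGroup 1 X := by
    rintro _ ⟨v, rfl⟩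
    exact isSectionClosed_polyActivityGroup 1 g hg v
  have hsplit : ∀ s ∈ Set.range (sectionAt g), s ∉ boundedSubgroup X → ∃ n, ∀ m ≥ n,
      ∃ v w : List X, v.length = m ∧ w.length = m ∧ v ≠ w ∧ sectionAt s v ∉ finitary X ∧
        sectionAt s w ∉ finitary X := by
    intro s hs hsD
    -- Two distinct non-finitary points give two distinct words with non-finitary sections at every
    -- sufficiently deep level; having finitely many states gives a common level `M`.
    have hinf : (singularSet (finitary X) s).Infinite := fun h => hsD ⟨hsG s hs, h⟩
    obtain ⟨y, hy, z, hz, hyz⟩ := hinf.nontrivial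
    obtain ⟨n, hn⟩ := exists_injOn_pre {y, z}
    refine ⟨n, fun m hm => ⟨pre y m, pre z m, length_pre _ _, length_pre _ _, fun h => hyz ?_,
      hy m, hz m⟩⟩
    exact hn m hm (by simp) (by simp) h
  choose! n hn using hsplit
  obtain ⟨M, hM⟩ := (Set.Finite.image n hg.1).bddAbove
  refine ⟨M, fun j => ?_⟩
  induction j with
  | zero => exact fun _ _ _ => Nat.zero_le _
  | succ j ih =>
    intro s hs hsD
    obtain ⟨v, w, hv, hw, hvw, hvF, hwF⟩ := hn s hs hsD M (hM ⟨s, hs, rfl⟩)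
    -- One word of length `M` has a section outside the bounded subgroup and carries the induction,
    -- contributing `j`; another one has a non-finitary section and contributes at least one more.
    obtain ⟨y, hy⟩ := singularSet_nonempty (isSectionClosed_polyActivityGroup 1)
      (fun _ => mem_boundedSubgroup_of_forall_letter) (hsG s hs) hsD
    obtain ⟨u, hu, hne, huF⟩ : ∃ u : List X, u.length = M ∧ pre y M ≠ u ∧
        sectionAt s u ∉ finitary X := by
      by_cases h : pre y M = v
      · exact ⟨w, hw, h ▸ hvw, hwF⟩
      · exact ⟨v, hv, h, hvF⟩
    have hsum := sum_activity_sectionAt_le s M (j * M) {pre y M, u} (by simp [hu])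
    rw [Finset.sum_pair hne] at hsum
    have h1 := ih (sectionAt s (pre y M)) (by
      obtain ⟨t, rfl⟩ := hs
      exact ⟨t ++ pre y M, sectionAt_append _ _ _⟩) (hy M)
    have h2 := activity_pos_of_notMem_finitary huF (j * M)
    rw [show (j + 1) * M = M + j * M by ring]
    omega

/-- Many singular points have distinct prefixes at some level, and each section there has activity
of slope at least `1 / M`. Together they would exceed the linear bound on the activity of `g`. -/
theorem finite_singularSet_boundedSubgroup [Finite X] {g : treeAut X}
    (hg : g ∈ polyActivityGroup 1 X) : (singularSet (boundedSubgroup X) g).Finite := by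
  classical
  by_contra hinf
  obtain ⟨M, hM⟩ := exists_le_activity hg
  obtain ⟨C, hC⟩ := exists_activity_le hg
  -- `B` singular points force slope `B / M`; the extra `1` in `B > C * M + 1` leaves room for a `j`
  -- that beats the constant `C * (k + 1)`.
  obtain ⟨B, hB⟩ := exists_nat_gt (C * M + 1)
  obtain ⟨s, hs, hsB⟩ := Set.Infinite.exists_subset_card_eq hinf B
  obtain ⟨k, hk⟩ := exists_injOn_pre s
  have hcard := Finset.card_image_of_injOn (hk k le_rfl)
  obtain ⟨j, hj⟩ := exists_nat_gt (C * (k + 1))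
  have hsum : B * j ≤ activity g (k + j * M) := by
    refine le_trans ?_ (sum_activity_sectionAt_le g k (j * M) (s.image fun y => pre y k) fun v hv => ?_)
    · rw [← hsB, ← hcard, ← smul_eq_mul]
      refine Finset.card_nsmul_le_sum _ _ _ fun v hv => ?_
      obtain ⟨y, hy, rfl⟩ := Finset.mem_image.1 hv
      exact hM j _ ⟨_, rfl⟩ (hs hy k)
    · obtain ⟨y, hy, rfl⟩ := Finset.mem_image.1 hv
      exact length_pre y k
  have hsum' : (B : ℝ) * j ≤ C * ((k + j * M : ℕ) + 1) :=
    le_trans (by exact_mod_cast hsum) (hC _)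
  push_cast at hsum'
  have hj0 : (0 : ℝ) ≤ j := j.cast_nonneg
  nlinarith [mul_le_mul_of_nonneg_right hB.le hj0]

theorem isFinitelySingularOver_finitary [Finite X] :
    IsFinitelySingularOver (boundedSubgroup X) (finitary X) where
  isSectionClosed_left := isSectionClosed_boundedSubgroup
  isSectionClosed_right := isSectionClosed_finitary
  isFiniteState _ hg := hg.1.1
  finite_singularSet _ hg := hg.2
  mem_of_forall_letter _ _ := mem_finitary_of_forall_letter

theorem isFinitelySingularOver_boundedSubgroup [Finite X] :
    IsFinitelySingularOver (polyActivityGroup 1 X) (boundedSubgroup X) where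
  isSectionClosed_left := isSectionClosed_polyActivityGroup 1
  isSectionClosed_right := isSectionClosed_boundedSubgroup
  isFiniteState _ hg := hg.1
  finite_singularSet _ hg := finite_singularSet_boundedSubgroup hg
  mem_of_forall_letter _ := mem_boundedSubgroup_of_forall_letter

theorem hasInvariantMean_polyActivityGroup_one [Finite X] :
    HasInvariantMean (polyActivityGroup 1 X) := by
  obtain ⟨m, hm, hinv, hfull⟩ := exists_mean_finset
    ((actHom X).comp (polyActivityGroup 1 X).subtype)
    (fun g => doubleSingularSet (boundedSubgroup X) (finitary X) g) fun S ε hε => by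
      obtain ⟨a, ha, hU, h1, h2⟩ := exists_small_energy
        isFinitelySingularOver_boundedSubgroup isFinitelySingularOver_finitary
        (fun g ⟨n, hn⟩ => ⟨n, fun v hv => hn v hv.ge⟩) (fun g hg => exists_activity_le hg)
        (S.finite_toSet.image Subtype.val) (by rintro _ ⟨s, -, rfl⟩; exact s.2) hε
      exact ⟨a, ha, hU, fun s hs => h1 s ⟨s, hs, rfl⟩, fun s hs => h2 s ⟨s, hs, rfl⟩⟩
  -- The same mean `m` is used for the bounded subgroup over the finitary group and for `P_1(X)`
  -- over the bounded subgroup.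
  refine isFinitelySingularOver_boundedSubgroup.hasInvariantMean
    (isFinitelySingularOver_finitary.hasInvariantMean hasInvariantMean_finitary hm
      (fun g hg => hinv ⟨g, hg.1⟩) fun g hg f f' hf hf' h => ?_) hm
      (fun g hg => hinv ⟨g, hg⟩) fun g hg f f' hf hf' h => ?_
  · exact hfull ⟨g, hg.1⟩ f f' hf hf' fun A hA => h A fun y hy => hA (Or.inr ⟨hg, hy⟩)
  · exact hfull ⟨g, hg⟩ f f' hf hf' fun A hA => h A fun y hy => hA (Or.inl hy)

end treeAut

theorem mainTheorem7 (X : Type*) [Finite X] :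
    IsAmenableGroup (polyActivityGroup 1 X) := by
  exact treeAut.hasInvariantMean_polyActivityGroup_one.isAmenableGroup
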